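/- **Setting.** On $\mathbb{R}^L$ ($L\ge 1$) write $\|x\|^2=\frac1L\sum_k x_k^2$. Let $\omega_L$ be the volume of the unit ball and $G(S_L)=\omega_L^{-1-2/L}\int_{|x|\le 1}\|x\|^2dx$ the normalized second moment of the $L$-dimensional sphere. Fix a full-rank lattice $\Lambda\subset\mathbb{R}^L$. A *three-channel lattice quantizer of shape $\Lambda$ and index $N\geq 1$* consists of lattices $\Lambda_\pi\subseteq\Lambda_s\subseteq\Lambda_c$, where $\Lambda_c$ is geometrically similar (scaling and orthogonal map) to $\Lambda$, $\Lambda_s$ is geometrically similar to $\Lambda_c$, $[\Lambda_c:\Lambda_s]=[\Lambda_s:\Lambda_\pi]=N$, together with an injective labeling $\alpha=(\alpha_0,\alpha_1,\alpha_2):\Lambda_c\to\Lambda_s^3$ with $\alpha(\lambda_c+\lambda_\pi)=\alpha(\lambda_c)+\lambda_\pi$ for $\lambda_\pi\in\Lambda_\pi$, and a radius $r$ such that the triples used by $\alpha$ are those with pairwise distances $\|\lambda_k-\lambda_l\|\le r/\sqrt L$ (all triples with pairwise distances $<r/\sqrt L$ are used, and none with a distance $>r/\sqrt L$; of the triples whose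 largest distance equals $r/\sqrt L$ any part may be used, so that the prescribed number of triples is obtained). Let $\nu$, $\nu_s=N\nu$ be the volumes of the fundamental regions of $\Lambda_c,\Lambda_s$, let $\tilde\nu=\omega_L r^L$, and let $\bar r$ be the radius of the ball of volume $\nu_s\sqrt N$. Let $T_j(\lambda_i)$ be the multiset of all $j$-th entries $\alpha_j(\lambda_c)$ with $\lambda_c\in\Lambda_c$ and $\alpha_i(\lambda_c)=\lambda_i$, and let $V_\pi(0)$ be the Voronoi cell of $\Lambda_\pi$ around $0$, of whose boundary only one point of $\Lambda_c$ from each class modulo $\Lambda_\pi$ is kept. **Claim.** There are sequences $(\rho_L)_{L\ge1}$ and $(\psi_L)_{L\ge1}$ of real numbers, with $\rho_L\to1$ as $L\to\infty$, such that for every $L\geq 1$ and every lattice $\Lambda\subset\mathbb{R}^L$, as $N\to\infty$, uniformly over all three-channel lattice quantizers of shape $\Lambda$ and index $N$ (at any scale, so in particular when $\nu_s\to0$), over all $i\ne j$ and all $\lambda_i\in\Lambda_s$: $$\frac{r}{\bar r}\to\psi_L,\qquad \frac{\sum_{\lambda_j\in T_j(\lambda_i)}\|\lambda_i-\lambda_j\|^2}{N\,\tilde\nu^{2/L}\,G(S_L)}\to\rho_L,\qquad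 \frac{\sum_{\lambda_c\in V_\pi(0)}\|\alpha_i(\lambda_c)-\alpha_j(\lambda_c)\|^2}{G(S_L)\,\psi_L^2\,N^2\,N^{2\cdot 3/(L(3-1))}\,\nu^{2/L}}\to\rho_L .$$ Thus, asymptotically as $L\to\infty$, $\sum_{\lambda_j\in T_j(\lambda_i)}\|\lambda_i-\lambda_j\|^2\approx N\tilde\nu^{2/L}G(S_L)$ becomes exact, and so does the corresponding sphere-second-moment form of the total pair sums. Moreover, for odd $L$, $$\rho_L=\frac{L+2}{L}\,\frac{\beta'_L}{\beta_L},\qquad \psi_L=\Big(\frac{\omega_L}{\omega_{L-1}}\Big)^{\frac1{2L}}\Big(\frac{L+1}{2L}\Big)^{\frac1{2L}}\beta_L^{-\frac1{2L}},$$ where, with $(a)_k$ the rising factorial, $\beta_L=B_L(0)$, $\beta'_L=B_L(2)$ and $$B_L(s)=\sum_{n=0}^{\frac{L+1}2}\binom{\frac{L+1}2}{n}2^{\frac{L+1}2-n}(-1)^n\sum_{k=0}^{\frac{L-1}2}\frac{(\frac{L+1}2)_k(\frac{1-L}2)_k}{(\frac{L+3}2)_k\,k!}\sum_{j=0}^k\binom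 kj\Big(\frac12\Big)^{k-j}(-1)^j\Big(\frac14\Big)^j\frac1{L+n+j+s};$$ in particular $\frac{L+2}{L}\frac{\beta'_L}{\beta_L}\to1$ as $L\to\infty$ through the odd integers. -/

import Mathlib

open MeasureTheory Filter Topology

/-- `ℝ^L` with its usual (not normalized) Euclidean norm. -/
abbrev Euc (L : ℕ) := EuclideanSpace ℝ (Fin L)

noncomputable section

/-- The squared `l₂`-norm normalized per dimension, `(1/L) ∑ x_k²`. -/
def normSqPerDim {L : ℕ} (x : Euc L) : ℝ := (1 / (L : ℝ)) * ∑ k, x k ^ 2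

/-- `ω_L`, the volume of the unit ball of `ℝ^L`. -/
def ballVol (L : ℕ) : ℝ := (volume (Metric.closedBall (0 : Euc L) 1)).toReal

/-- The dimensionless normalized second moment of a region `V ⊆ ℝ^L` (about the origin). -/
def normalizedSecondMoment {L : ℕ} (V : Set (Euc L)) : ℝ :=
  (∫ x in V, normSqPerDim x) / (volume V).toReal ^ (1 + 2 / (L : ℝ))

/-- `G(S_L)`, the normalized second moment of the `L`-dimensional sphere (solid ball). -/
def sphereG (L : ℕ) : ℝ := normalizedSecondMoment (Metric.closedBall (0 : Euc L) 1)

/-- Geometrical similarity: `M` arises from `Λ` by a change of scale and an orthogonal map. -/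
def GeomSimilar {L : ℕ} (Λ M : Submodule ℤ (Euc L)) : Prop :=
  ∃ (c : ℝ) (U : Euc L ≃ₗᵢ[ℝ] Euc L), 0 < c ∧ ∀ x, x ∈ M ↔ ∃ y ∈ Λ, x = c • U y

/-- The closed Voronoi cell of `Λ` around the origin. -/
def voronoiCell {L : ℕ} (Λ : Submodule ℤ (Euc L)) : Set (Euc L) :=
  {x | ∀ y ∈ Λ, normSqPerDim x ≤ normSqPerDim (x - y)}

/-- A `K`-channel lattice vector quantizer with its index assignment; all lattices have the shape
of `Λ`. The `K`-tuples in use are those whose entries have pairwise Euclidean distance at most `r`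
(normalized distance at most `r / √L`); since the number of tuples is prescribed by the indices,
only part of the tuples whose largest pairwise distance is exactly `r` need be used. -/
structure MDQuantizer (K L : ℕ) (Λ : Submodule ℤ (Euc L)) where
  /-- central lattice -/
  Λc : Submodule ℤ (Euc L)
  /-- side lattice -/
  Λs : Submodule ℤ (Euc L)
  /-- product lattice -/
  Λp : Submodule ℤ (Euc L)
  similar_c : GeomSimilar Λ Λc
  similar_s : GeomSimilar Λc Λs
  s_le_c : Λs ≤ Λc
  p_le_s : Λp ≤ Λs
  /-- the index of the side lattice in the central lattice -/
  N : ℕ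
  N_pos : 0 < N
  index_s : Λs.toAddSubgroup.relIndex Λc.toAddSubgroup = N
  index_p : Λp.toAddSubgroup.relIndex Λs.toAddSubgroup = N
  /-- the labeling function -/
  α : Λc → Fin K → Λs
  α_injective : Function.Injective α
  α_shift : ∀ c c' : Λc, ∀ p ∈ Λp, (c' : Euc L) = c + p →
    ∀ k, (α c' k : Euc L) = α c k + p
  /-- the radius of the sphere `Ṽ` centered at the side lattice points -/
  r : ℝ
  tuples_le : ∀ c k l, ‖(α c k : Euc L) - (α c l : Euc L)‖ ≤ r
  tuples_lt : ∀ t : Fin K → Λs, (∀ k l, ‖(t k : Euc L) - (t l : Euc L)‖ < r) → t ∈ Set.range α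
  /-- The central lattice points in the Voronoi cell `V_π(0)` of the product lattice, where of
  boundary points that differ by an element of the product lattice only one is kept. -/
  cell : Finset Λc
  cell_subset : ∀ c ∈ cell, (c : Euc L) ∈ voronoiCell Λp
  cell_repr : ∀ c : Λc, ∃! d : Λc, d ∈ cell ∧ (c : Euc L) - d ∈ Λp

namespace MDQuantizer

variable {K L : ℕ} {Λ : Submodule ℤ (Euc L)} (S : MDQuantizer K L Λ)

/-- `ν`, the volume of the fundamental regions of the central lattice. -/
def nu : ℝ := ZLattice.covolume S.Λc

/-- `ν_s`, the volume of the fundamental regions of the side lattice. -/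
def nuS : ℝ := ZLattice.covolume S.Λs

/-- `ν̃`, the volume of the sphere `Ṽ` of radius `r`. -/
def nuTilde : ℝ := (volume (Metric.closedBall (0 : Euc L) S.r)).toReal

/-- `∑_{λ_j ∈ T_j(λ_i)} ‖λ_i - λ_j‖²`, where `T_j(λ_i)` is the multiset of the `j`-th entries of all
the `K`-tuples in use that have `i`-th entry `λ_i = x`. The sum is a finite one. -/
def pairSum (i j : Fin K) (x : S.Λs) : ℝ :=
  ∑ᶠ c ∈ {c : S.Λc | S.α c i = x}, normSqPerDim ((x : Euc L) - (S.α c j : Euc L))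

/-- `∑_{λ_c ∈ V_π(0)} ‖α_i(λ_c) - α_j(λ_c)‖²`. -/
def totalPairSum (i j : Fin K) : ℝ :=
  ∑ c ∈ S.cell, normSqPerDim ((S.α c i : Euc L) - (S.α c j : Euc L))

/-- The radius of the sphere of volume `ν_s N^{1/(K-1)}`, the theoretical lower bound for `ν̃`. -/
def rBar : ℝ := (S.nuS * (S.N : ℝ) ^ (1 / ((K : ℝ) - 1)) / ballVol L) ^ (1 / (L : ℝ))

/-- The factor by which the radius of `Ṽ` exceeds the theoretical lower bound. -/
def expansion : ℝ := S.r / S.rBar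

end MDQuantizer

/-- The triple sum with the last factor `1 / (L + n + j + s)` (meant for odd `L`). -/
def betaSum (L s : ℕ) : ℝ :=
  ∑ n ∈ Finset.range ((L + 1) / 2 + 1),
    (((L + 1) / 2).choose n : ℝ) * 2 ^ ((L + 1) / 2 - n) * (-1) ^ n *
    ∑ k ∈ Finset.range ((L - 1) / 2 + 1),
      ((ascPochhammer ℝ k).eval (((L : ℝ) + 1) / 2) * (ascPochhammer ℝ k).eval ((1 - (L : ℝ)) / 2)) /
        ((ascPochhammer ℝ k).eval (((L : ℝ) + 3) / 2) * (k.factorial : ℝ)) *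
      ∑ j ∈ Finset.range (k + 1),
        (k.choose j : ℝ) * (1 / 2) ^ (k - j) * (-1) ^ j * (1 / 4) ^ j *
          (1 / ((L : ℝ) + n + j + s))

/-- `β_L`, for odd `L`. -/
def beta (L : ℕ) : ℝ := betaSum L 0

/-- `β'_L`, for odd `L`. -/
def beta' (L : ℕ) : ℝ := betaSum L 2

/-- The closed form of the dimensionless expansion factor `ψ_L` for `K = 3` and odd `L`. -/
def psiOdd (L : ℕ) : ℝ :=
  (ballVol L / ballVol (L - 1)) ^ (1 / (2 * (L : ℝ))) *
    (((L : ℝ) + 1) / (2 * L)) ^ (1 / (2 * (L : ℝ))) * beta L ^ (-(1 / (2 * (L : ℝ))))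

end

/-! Fix the label `x` of channel `i`. Subtracting `x` from the other two labels and undoing the
similarity from `Λ` to `Λs` (of ratio `c`) turns the used triples through `x` into pairs of points
of `Λ` whose distances to each other and to the origin are at most `R = r / c`, with freedom only on
the boundary (`MDQuantizer.exists_pairs_of_fiber`). Riemann sums over the convex body `pairBody`
show that the number of such pairs is asymptotic to `R ^ (2L) M₀ / κ²` and the sum of the squared
norms of their first entries to `R ^ (2L + 2) M₂ / κ²`, where `M_s = pairMoment L s` and `κ` is the
covolume of `Λ` (`sum_latticePairs_asymptotic`).

A single fiber need not contain exactly `N` triples. By shift invariance, however, the fibers over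
representatives of `Λs / Λp` form a system of representatives of `Λc / Λp`, so the average fiber
size is exactly `N` (`MDQuantizer.exists_sum_cell_eq`). Hence `R → ∞` as `N → ∞`, uniformly, and `N
/ R ^ (2L)` converges. All three quotients are continuous functions of convergent quantities, with
`ρ_L = (L + 2) / L * (M₂ / M₀)`.

For `L → ∞`, Fubini and polar coordinates turn `M_s` into a radial integral of the volume of a lens
(`pairMoment_eq`). Integration by parts splits off a boundary term that does not depend on `s`; the
remaining integrals concentrate at `t = 1`, which squeezes `ρ_L` between `1 - 6 / (L + 3)` and `1`.
For odd `L` the lens integrand is a polynomial, and expanding it yields the triple sum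
(`betaSum_eq`). -/

noncomputable section

/-! ### Radial moments and their concentration at `t = 1` -/

/-- The integral `∫_{t/2}^1 (1 - u²)^{n/2} du`: up to the factor `2 ω_n`, the volume of the
intersection of two unit balls of `ℝ^{n+1}` whose centres have distance `t`. -/
def chordIntegral (n : ℕ) (t : ℝ) : ℝ := ∫ u in (t / 2)..1, √(1 - u ^ 2) ^ n

/-- The radial moments `∫_0^1 t^{n+s} ∫_{t/2}^1 (1 - u²)^{n/2} du dt`. -/
def radialMoment (n s : ℕ) : ℝ := ∫ t in (0 : ℝ)..1, t ^ (n + s) * chordIntegral n t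

/-- The boundary-term-free part of a radial moment after integrating by parts. -/
def chordMoment (n s : ℕ) : ℝ := ∫ t in (0 : ℝ)..1, t ^ (n + 1 + s) * √(1 - (t / 2) ^ 2) ^ n

lemma continuous_sqrt_one_sub_sq_pow (n : ℕ) : Continuous fun u : ℝ => √(1 - u ^ 2) ^ n := by
  fun_prop

lemma hasDerivAt_chordIntegral (n : ℕ) (t : ℝ) :
    HasDerivAt (chordIntegral n) (-(1 / 2 * √(1 - (t / 2) ^ 2) ^ n)) t := by
  have hc := continuous_sqrt_one_sub_sq_pow n
  have h : HasDerivAt (fun x : ℝ => ∫ u in x..1, √(1 - u ^ 2) ^ n) (-√(1 - (t / 2) ^ 2) ^ n)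
      (t / 2) :=
    intervalIntegral.integral_hasDerivAt_left (hc.intervalIntegrable _ _)
      (hc.stronglyMeasurableAtFilter _ _) hc.continuousAt
  have h2 : HasDerivAt (fun t : ℝ => t / 2) (1 / 2) t := (hasDerivAt_id t).div_const 2
  refine (h.comp t h2).congr_deriv ?_
  ring

lemma continuous_chordIntegral (n : ℕ) : Continuous (chordIntegral n) :=
  continuous_iff_continuousAt.2 fun t => (hasDerivAt_chordIntegral n t).continuousAt

lemma chordIntegral_one_pos (n : ℕ) : 0 < chordIntegral n 1 := by
  refine intervalIntegral.intervalIntegral_pos_of_pos_on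
    ((continuous_sqrt_one_sub_sq_pow n).intervalIntegrable _ _) (fun u hu => ?_) (by norm_num)
  have h1 := hu.1
  have h2 := hu.2
  exact pow_pos (Real.sqrt_pos.2 (by nlinarith)) _

/-- The boundary term `chordIntegral n 1` is the same for all `s`, so comparing `s = 2` with `s = 0`
amounts to comparing the two `chordMoment`s. -/
lemma radialMoment_by_parts (n s : ℕ) :
    ((n : ℝ) + 1 + s) * radialMoment n s = chordIntegral n 1 + 1 / 2 * chordMoment n s := by
  have hd : ∀ t : ℝ, HasDerivAt (fun t => t ^ (n + 1 + s) * chordIntegral n t)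
      (((n : ℝ) + 1 + s) * (t ^ (n + s) * chordIntegral n t)
        - 1 / 2 * (t ^ (n + 1 + s) * √(1 - (t / 2) ^ 2) ^ n)) t := by
    intro t
    refine ((hasDerivAt_pow (n + 1 + s) t).mul (hasDerivAt_chordIntegral n t)).congr_deriv ?_
    rw [show n + 1 + s - 1 = n + s by omega]
    push_cast
    ring
  have hW := continuous_chordIntegral n
  have key := intervalIntegral.integral_eq_sub_of_hasDerivAt (a := 0) (b := 1)
    (fun t _ => hd t) (Continuous.intervalIntegrable (by fun_prop) _ _)
  rw [intervalIntegral.integral_sub (Continuous.intervalIntegrable (by fun_prop) _ _)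
    (Continuous.intervalIntegrable (by fun_prop) _ _), intervalIntegral.integral_const_mul,
    intervalIntegral.integral_const_mul] at key
  simp only [one_pow, one_mul, zero_pow (show n + 1 + s ≠ 0 by omega), zero_mul, sub_zero] at key
  unfold radialMoment chordMoment
  linarith

lemma chordMoment_nonneg (n s : ℕ) : 0 ≤ chordMoment n s :=
  intervalIntegral.integral_nonneg (by norm_num) fun t ht => by
    have := ht.1
    positivity

lemma radialMoment_pos (n s : ℕ) : 0 < radialMoment n s := by
  have h := radialMoment_by_parts n s
  have h1 := chordIntegral_one_pos n
  have h2 := chordMoment_nonneg n s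
  have h3 : 0 < ((n : ℝ) + 1 + s) * radialMoment n s := by rw [h]; positivity
  exact pos_of_mul_pos_right h3 (by positivity)

/-- `t ↦ t √(1 - t²/4)`, whose derivative times itself is `t (1 - t²/2)`. -/
def chordProfile (t : ℝ) : ℝ := t * √(1 - (t / 2) ^ 2)

lemma chordProfile_sq {t : ℝ} (h0 : 0 ≤ t) (h1 : t ≤ 1) :
    chordProfile t ^ 2 = t ^ 2 * (1 - (t / 2) ^ 2) := by
  rw [chordProfile, mul_pow, Real.sq_sqrt (by nlinarith)]

lemma continuous_chordProfile : Continuous chordProfile := by unfold chordProfile; fun_prop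

lemma integral_chordProfile_pow (k : ℕ) :
    ∫ t in (0 : ℝ)..1, t * (1 - t ^ 2 / 2) * chordProfile t ^ k
      = chordProfile 1 ^ (k + 2) / (k + 2) := by
  have hd : ∀ t ∈ Set.uIcc (0 : ℝ) 1, HasDerivAt (fun t => chordProfile t ^ (k + 2) / (k + 2))
      (t * (1 - t ^ 2 / 2) * chordProfile t ^ k) t := by
    intro t ht
    rw [Set.uIcc_of_le zero_le_one] at ht
    have hpos : 0 < 1 - (t / 2) ^ 2 := by nlinarith [ht.1, ht.2]
    have hq : HasDerivAt (fun t : ℝ => 1 - (t / 2) ^ 2) (-(t / 2)) t := by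
      have h2 : HasDerivAt (fun t : ℝ => t / 2) (1 / 2) t := (hasDerivAt_id t).div_const 2
      refine ((h2.pow 2).const_sub 1).congr_deriv ?_
      simp
      ring
    have hg : HasDerivAt chordProfile
        (1 * √(1 - (t / 2) ^ 2) + t * (-(t / 2) / (2 * √(1 - (t / 2) ^ 2)))) t :=
      (hasDerivAt_id t).mul (hq.sqrt hpos.ne')
    refine ((hg.pow (k + 2)).div_const ((k : ℝ) + 2)).congr_deriv ?_
    have hs : √(1 - (t / 2) ^ 2) ≠ 0 := (Real.sqrt_pos.2 hpos).ne'
    have hs2 : √(1 - (t / 2) ^ 2) ^ 2 = 1 - (t / 2) ^ 2 := Real.sq_sqrt hpos.le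
    have hk : (k : ℝ) + 2 ≠ 0 := by positivity
    rw [show k + 2 - 1 = k + 1 by omega, pow_succ, show chordProfile t = t * √(1 - (t / 2) ^ 2)
      from rfl]
    push_cast
    generalize √(1 - (t / 2) ^ 2) = w at hs hs2 ⊢
    field_simp
    rw [hs2]
    ring
  have hc := continuous_chordProfile
  rw [intervalIntegral.integral_eq_sub_of_hasDerivAt hd
    (Continuous.intervalIntegrable (by fun_prop) _ _)]
  simp [chordProfile]

lemma chordMoment_zero_eq (n : ℕ) :
    chordMoment n 0 = ∫ t in (0 : ℝ)..1, t * chordProfile t ^ n := by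
  unfold chordMoment chordProfile
  congr 1
  ext t
  ring

lemma chordMoment_two_eq (n : ℕ) :
    chordMoment n 2 = ∫ t in (0 : ℝ)..1, t ^ 3 * chordProfile t ^ n := by
  unfold chordMoment chordProfile
  congr 1
  ext t
  ring

lemma chordProfile_nonneg {t : ℝ} (ht : 0 ≤ t) : 0 ≤ chordProfile t := by
  unfold chordProfile; positivity

/-- Inserting the weight `1 - t ^ 2 / 2 ≤ 1` makes the integrand an exact derivative. -/
lemma chordMoment_zero_ge (n : ℕ) :
    chordProfile 1 ^ (n + 2) / (n + 2) ≤ chordMoment n 0 := by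
  have hc := continuous_chordProfile
  rw [← integral_chordProfile_pow, chordMoment_zero_eq]
  refine intervalIntegral.integral_mono_on zero_le_one
    (Continuous.intervalIntegrable (by fun_prop) _ _)
    (Continuous.intervalIntegrable (by fun_prop) _ _) fun t ht => ?_
  have h := pow_nonneg (chordProfile_nonneg ht.1) n
  refine mul_le_mul_of_nonneg_right ?_ h
  nlinarith [ht.1, pow_nonneg ht.1 3]

/-- The weight `t - t ^ 3` vanishes at `t = 1`, where the mass sits. It is dominated by a
combination of two exactly integrable weights which also vanishes there, and this gains a factor of
order `1 / n` over `chordMoment_zero_ge`. -/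
lemma chordMoment_sub_le (n : ℕ) :
    chordMoment n 0 - chordMoment n 2
      ≤ 3 * (chordProfile 1 ^ (n + 2) * (2 / ((n + 2) * (n + 4)))) := by
  have hc := continuous_chordProfile
  have h34 : chordProfile 1 ^ 2 = 3 / 4 := by rw [chordProfile_sq] <;> norm_num
  -- The constant `4 / 3` is `1 / chordProfile 1 ^ 2`; thus `1 - 4 / 3 * chordProfile t ^ 2 = (1 - t
  -- ^ 2) * (1 - t ^ 2 / 3)` on `[0, 1]`.
  have e : chordProfile 1 ^ (n + 2) * (2 / (((n : ℝ) + 2) * (n + 4)))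
      = (∫ t in (0 : ℝ)..1, t * (1 - t ^ 2 / 2) * chordProfile t ^ n)
        - 4 / 3 * ∫ t in (0 : ℝ)..1, t * (1 - t ^ 2 / 2) * chordProfile t ^ (n + 2) := by
    rw [integral_chordProfile_pow, integral_chordProfile_pow,
      show n + 2 + 2 = (n + 2) + 2 from rfl, pow_add _ (n + 2) 2, h34]
    have : (n : ℝ) + 2 ≠ 0 := by positivity
    have : (n : ℝ) + 4 ≠ 0 := by positivity
    have : (n : ℝ) + 2 + 2 ≠ 0 := by positivity
    push_cast
    field_simp
    ring
  rw [e, chordMoment_zero_eq, chordMoment_two_eq, ← intervalIntegral.integral_const_mul,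
    ← intervalIntegral.integral_sub (Continuous.intervalIntegrable (by fun_prop) _ _)
    (Continuous.intervalIntegrable (by fun_prop) _ _),
    ← intervalIntegral.integral_sub (Continuous.intervalIntegrable (by fun_prop) _ _)
    (Continuous.intervalIntegrable (by fun_prop) _ _), ← intervalIntegral.integral_const_mul]
  refine intervalIntegral.integral_mono_on zero_le_one
    (Continuous.intervalIntegrable (by fun_prop) _ _)
    (Continuous.intervalIntegrable (by fun_prop) _ _) fun t ht => ?_
  have h := pow_nonneg (chordProfile_nonneg ht.1) n
  have e1 : t * chordProfile t ^ n - t ^ 3 * chordProfile t ^ n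
      = (t - t ^ 3) * chordProfile t ^ n := by ring
  have e2 : 3 * (t * (1 - t ^ 2 / 2) * chordProfile t ^ n
      - 4 / 3 * (t * (1 - t ^ 2 / 2) * chordProfile t ^ (n + 2)))
      = (3 * (t * (1 - t ^ 2 / 2) * ((1 - t ^ 2) * (1 - t ^ 2 / 3)))) * chordProfile t ^ n := by
    rw [pow_add _ n 2, chordProfile_sq ht.1 ht.2]
    ring
  rw [e1, e2]
  refine mul_le_mul_of_nonneg_right ?_ h
  have h2 : t ^ 2 ≤ 1 := pow_le_one₀ ht.1 ht.2
  -- The factor `3` suffices because the two factors are at least `1 / 2` and `2 / 3`.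
  have h3 : 0 ≤ (1 - t ^ 2 / 2 - 1 / 2) * (1 - t ^ 2 / 3) :=
    mul_nonneg (by linarith) (by linarith)
  have h4 : 1 ≤ 3 * ((1 - t ^ 2 / 2) * (1 - t ^ 2 / 3)) := by nlinarith
  have h5 : 0 ≤ t * (1 - t ^ 2) := mul_nonneg ht.1 (by linarith)
  nlinarith [mul_le_mul_of_nonneg_left h4 h5]

lemma chordMoment_two_le_zero (n : ℕ) : chordMoment n 2 ≤ chordMoment n 0 := by
  have hc := continuous_chordProfile
  rw [chordMoment_zero_eq, chordMoment_two_eq]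
  refine intervalIntegral.integral_mono_on zero_le_one
    (Continuous.intervalIntegrable (by fun_prop) _ _)
    (Continuous.intervalIntegrable (by fun_prop) _ _) fun t ht => ?_
  have h := pow_nonneg (chordProfile_nonneg ht.1) n
  refine mul_le_mul_of_nonneg_right ?_ h
  have h2 : t ^ 2 ≤ 1 := pow_le_one₀ ht.1 ht.2
  nlinarith [ht.1]

/-- The radial second moment ratio tends to one: the mass concentrates at `t = 1`. -/
lemma tendsto_radialMoment_ratio :
    Tendsto (fun n : ℕ => ((n : ℝ) + 3) / (n + 1) * (radialMoment n 2 / radialMoment n 0))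
      atTop (𝓝 1) := by
  -- The quotient of the bounds in `chordMoment_sub_le` and `chordMoment_zero_ge` is `6 / (n + 4)`.
  have hlim : Tendsto (fun n : ℕ => 1 - 6 / ((n : ℝ) + 4)) atTop (𝓝 1) := by
    have : Tendsto (fun n : ℕ => 6 / ((n : ℝ) + 4)) atTop (𝓝 0) :=
      tendsto_const_nhds.div_atTop
        (tendsto_atTop_add_const_right _ _ tendsto_natCast_atTop_atTop)
    simpa using this.const_sub 1
  have hEq : ∀ n : ℕ, ((n : ℝ) + 3) / (n + 1) * (radialMoment n 2 / radialMoment n 0)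
      = (chordIntegral n 1 + 1 / 2 * chordMoment n 2)
        / (chordIntegral n 1 + 1 / 2 * chordMoment n 0) := by
    intro n
    rw [← radialMoment_by_parts, ← radialMoment_by_parts]
    have := radialMoment_pos n 0
    push_cast
    field_simp
    ring
  have hden : ∀ n : ℕ, 0 < chordIntegral n 1 + 1 / 2 * chordMoment n 0 := fun n => by
    have := chordIntegral_one_pos n
    have := chordMoment_nonneg n 0
    positivity
  refine tendsto_of_tendsto_of_tendsto_of_le_of_le hlim tendsto_const_nhds
    (fun n => ?_) fun n => ?_
  · simp only [hEq]
    rw [le_div_iff₀ (hden n)]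
    have h1 := chordIntegral_one_pos n
    have h2 := chordMoment_sub_le n
    have h3 := chordMoment_zero_ge n
    have h4 : 3 * (chordProfile 1 ^ (n + 2) * (2 / (((n : ℝ) + 2) * (n + 4))))
        = 6 / ((n : ℝ) + 4) * (chordProfile 1 ^ (n + 2) / (n + 2)) := by
      field_simp
      ring
    have h5 : 6 / ((n : ℝ) + 4) * (chordProfile 1 ^ (n + 2) / (n + 2))
        ≤ 6 / ((n : ℝ) + 4) * chordMoment n 0 := mul_le_mul_of_nonneg_left h3 (by positivity)
    have h6 : 0 ≤ 6 / ((n : ℝ) + 4) * chordIntegral n 1 := by positivity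
    nlinarith
  · simp only [hEq]
    rw [div_le_one (hden n)]
    linarith [chordMoment_two_le_zero n]

/-! ### The triple sum in odd dimensions -/

/-- Both sides are the rising factorial of `m + 1` of length `k + 1`, with its last or its first
factor split off. -/
lemma ascPochhammer_eval_ratio (m k : ℕ) :
    (ascPochhammer ℝ k).eval ((m : ℝ) + 1) * (m + 1 + k)
      = (m + 1) * (ascPochhammer ℝ k).eval ((m : ℝ) + 2) := by
  rw [← ascPochhammer_succ_eval, ascPochhammer_succ_left]
  simp
  left
  ring_nf

lemma ascPochhammer_eval_neg_natCast (m k : ℕ) :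
    (ascPochhammer ℝ k).eval (-(m : ℝ)) = (-1) ^ k * ((m.choose k : ℝ) * k.factorial) := by
  rw [ascPochhammer_eval_neg_eq_descPochhammer, descPochhammer_eval_eq_descFactorial,
    Nat.descFactorial_eq_factorial_mul_choose]
  push_cast
  ring

/-- The coefficients of the hypergeometric polynomial `₂F₁(m+1, -m; m+2; z)`. -/
lemma hypergeometric_coeff (m k : ℕ) :
    (ascPochhammer ℝ k).eval ((m : ℝ) + 1) * (ascPochhammer ℝ k).eval (-(m : ℝ)) /
        ((ascPochhammer ℝ k).eval ((m : ℝ) + 2) * (k.factorial : ℝ))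
      = (m + 1) / (m + 1 + k) * ((-1) ^ k * (m.choose k : ℝ)) := by
  have h1 := ascPochhammer_eval_ratio m k
  have h2 : 0 < (ascPochhammer ℝ k).eval ((m : ℝ) + 2) := ascPochhammer_pos k _ (by positivity)
  have h3 : (k.factorial : ℝ) ≠ 0 := by positivity
  have h4 : (m : ℝ) + 1 + k ≠ 0 := by positivity
  rw [ascPochhammer_eval_neg_natCast, div_mul_eq_mul_div, div_eq_div_iff (by positivity) h4]
  linear_combination ((-1) ^ k * ((m.choose k : ℝ) * k.factorial)) * h1

/-- For an even exponent the square root disappears; `1 - u ^ 2 = (1 - u) * (2 - (1 - u))` is then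
expanded in powers of `1 - u`. -/
lemma chordIntegral_even (m : ℕ) {t : ℝ} (h0 : 0 ≤ t) (h2 : t ≤ 2) :
    chordIntegral (2 * m) t = ∑ k ∈ Finset.range (m + 1),
      (-1) ^ k * (m.choose k : ℝ) * 2 ^ (m - k) * ((1 - t / 2) ^ (m + k + 1) / (m + 1 + k)) := by
  have e : chordIntegral (2 * m) t = ∫ u in (t / 2)..1, ∑ k ∈ Finset.range (m + 1),
      (-1) ^ k * (m.choose k : ℝ) * 2 ^ (m - k) * (1 - u) ^ (m + k) := by
    refine intervalIntegral.integral_congr fun u hu => ?_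
    rw [Set.uIcc_of_le (by linarith)] at hu
    have h1 : 0 ≤ 1 - u ^ 2 := by nlinarith [hu.1, hu.2]
    rw [pow_mul, Real.sq_sqrt h1, show 1 - u ^ 2 = (1 - u) * (-(1 - u) + 2) by ring, mul_pow,
      add_pow, Finset.mul_sum]
    refine Finset.sum_congr rfl fun k _ => ?_
    rw [neg_pow, pow_add]
    ring
  rw [e, intervalIntegral.integral_finsetSum fun k _ =>
    Continuous.intervalIntegrable (by fun_prop) _ _]
  refine Finset.sum_congr rfl fun k _ => ?_
  rw [intervalIntegral.integral_const_mul,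
    intervalIntegral.integral_comp_sub_left (fun u => u ^ (m + k)) 1, integral_pow]
  push_cast
  simp only [sub_self, zero_pow (show m + k + 1 ≠ 0 by omega), sub_zero]
  ring_nf

lemma two_sub_pow (m : ℕ) (t : ℝ) :
    (2 - t) ^ m = ∑ n ∈ Finset.range (m + 1), (m.choose n : ℝ) * 2 ^ (m - n) * (-1) ^ n * t ^ n := by
  rw [sub_eq_neg_add, add_pow]
  refine Finset.sum_congr rfl fun k _ => ?_
  rw [neg_pow]
  ring

lemma half_sub_quarter_pow (k : ℕ) (t : ℝ) :
    (1 / 2 - t / 4) ^ k = ∑ j ∈ Finset.range (k + 1),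
      (k.choose j : ℝ) * (1 / 2) ^ (k - j) * (-1) ^ j * (1 / 4) ^ j * t ^ j := by
  rw [sub_eq_neg_add, add_pow]
  refine Finset.sum_congr rfl fun j _ => ?_
  rw [neg_pow, div_eq_mul_one_div t, mul_pow]
  ring

lemma chordIntegral_even_eq_hypergeometric (m : ℕ) {t : ℝ} (h0 : 0 ≤ t) (h2 : t ≤ 2) :
    (2 * (m : ℝ) + 2) * chordIntegral (2 * m) t = (2 - t) ^ (m + 1) *
      ∑ k ∈ Finset.range (m + 1),
        (m + 1) / (m + 1 + k) * ((-1) ^ k * (m.choose k : ℝ)) * (1 / 2 - t / 4) ^ k := by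
  rw [chordIntegral_even m h0 h2, Finset.mul_sum, Finset.mul_sum]
  refine Finset.sum_congr rfl fun k hk => ?_
  have hk' : k ≤ m := by simpa [Nat.lt_succ_iff] using hk
  obtain ⟨d, rfl⟩ := Nat.exists_eq_add_of_le hk'
  have h4 : ((k + d : ℕ) : ℝ) + 1 + k ≠ 0 := by positivity
  rw [show 1 - t / 2 = (2 - t) / 2 by ring, show 1 / 2 - t / 4 = (2 - t) / 4 by ring,
    div_pow, div_pow, Nat.add_sub_cancel_left, show k + d + k + 1 = (k + d + 1) + k by ring,
    pow_add (2 - t), show (4 : ℝ) ^ k = 2 ^ k * 2 ^ k by rw [← mul_pow]; norm_num,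
    show k + d + 1 + k = k + k + d + 1 by ring, pow_succ (2 : ℝ), pow_add (2 : ℝ) (k + k),
    pow_add (2 : ℝ) k]
  field_simp

/-- After expanding both powers binomially only monomials `t ^ (2 * m + n + j + s)` remain; with `L
= 2 * m + 1` they integrate to the last factor of `betaSum`. -/
lemma betaSum_eq (m s : ℕ) :
    betaSum (2 * m + 1) s = (2 * (m : ℝ) + 2) * radialMoment (2 * m) s := by
  have hint : ∀ a : ℕ, ∫ t in (0 : ℝ)..1, t ^ a = 1 / ((a : ℝ) + 1) := fun a => by
    rw [integral_pow]; simp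
  have e : (2 * (m : ℝ) + 2) * radialMoment (2 * m) s
      = ∫ t in (0 : ℝ)..1, ∑ n ∈ Finset.range (m + 1 + 1), ∑ k ∈ Finset.range (m + 1),
        ∑ j ∈ Finset.range (k + 1),
          (((m + 1).choose n : ℝ) * 2 ^ (m + 1 - n) * (-1) ^ n *
          ((m + 1) / (m + 1 + k) * ((-1) ^ k * (m.choose k : ℝ)) *
          ((k.choose j : ℝ) * (1 / 2) ^ (k - j) * (-1) ^ j * (1 / 4) ^ j))) *
            t ^ (2 * m + n + j + s) := by
    rw [radialMoment, ← intervalIntegral.integral_const_mul]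
    refine intervalIntegral.integral_congr fun t ht => ?_
    rw [Set.uIcc_of_le zero_le_one] at ht
    rw [mul_left_comm, chordIntegral_even_eq_hypergeometric m ht.1 (by linarith [ht.2]),
      two_sub_pow, Finset.sum_mul, Finset.mul_sum]
    refine Finset.sum_congr rfl fun n _ => ?_
    rw [Finset.mul_sum, Finset.mul_sum]
    refine Finset.sum_congr rfl fun k _ => ?_
    rw [half_sub_quarter_pow, Finset.mul_sum, Finset.mul_sum, Finset.mul_sum]
    refine Finset.sum_congr rfl fun j _ => ?_
    ring
  rw [e, intervalIntegral.integral_finsetSum fun _ _ =>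
    Continuous.intervalIntegrable (by fun_prop) _ _, betaSum]
  have hL1 : (2 * m + 1 + 1) / 2 = m + 1 := by omega
  have hL2 : (2 * m + 1 - 1) / 2 = m := by omega
  rw [hL1, hL2]
  refine Finset.sum_congr rfl fun n _ => ?_
  rw [intervalIntegral.integral_finsetSum fun _ _ =>
    Continuous.intervalIntegrable (by fun_prop) _ _, Finset.mul_sum]
  refine Finset.sum_congr rfl fun k _ => ?_
  have h1 : (((2 * m + 1 : ℕ) : ℝ) + 1) / 2 = m + 1 := by push_cast; ring
  have h2 : (1 - ((2 * m + 1 : ℕ) : ℝ)) / 2 = -m := by push_cast; ring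
  have h3 : (((2 * m + 1 : ℕ) : ℝ) + 3) / 2 = m + 2 := by push_cast; ring
  rw [intervalIntegral.integral_finsetSum fun _ _ =>
    Continuous.intervalIntegrable (by fun_prop) _ _, h1, h2, h3, hypergeometric_coeff,
    Finset.mul_sum, Finset.mul_sum]
  refine Finset.sum_congr rfl fun j _ => ?_
  rw [intervalIntegral.integral_const_mul, hint]
  push_cast
  ring_nf

/-! ### Volumes of lenses and the moments of `pairBody` -/

lemma volume_real_closedBall {n : ℕ} (x : Euc n) {r : ℝ} (hr : 0 ≤ r) :
    volume.real (Metric.closedBall x r) = r ^ n * ballVol n := by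
  rw [measureReal_def, Measure.addHaar_closedBall' _ _ hr, ENNReal.toReal_mul,
    ENNReal.toReal_ofReal (by positivity), finrank_euclideanSpace_fin, ballVol]

lemma ballVol_pos (n : ℕ) : 0 < ballVol n :=
  ENNReal.toReal_pos (Metric.measure_closedBall_pos volume _ one_pos).ne'
    (isCompact_closedBall (0 : Euc n) 1).measure_ne_top

lemma ballVol_eq_ball (n : ℕ) : ballVol n = volume.real (Metric.ball (0 : Euc n) 1) := by
  rw [ballVol, Measure.addHaar_unitClosedBall_eq_addHaar_unitBall, measureReal_def]

/-- The volume of the intersection of the unit balls around `0` and `b`. -/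
def lensVol {L : ℕ} (b : Euc L) : ℝ :=
  volume.real (Metric.closedBall 0 1 ∩ Metric.closedBall b 1)

/-- The reflection exchanging `b` and `b'` fixes the origin and preserves volume. -/
lemma lensVol_eq_of_norm_eq {L : ℕ} {b b' : Euc L} (h : ‖b‖ = ‖b'‖) : lensVol b = lensVol b' := by
  set U := (Submodule.span ℝ {b - b'})ᗮ.reflection
  have hU : U b = b' := Submodule.reflection_sub h
  have hpre : U ⁻¹' (Metric.closedBall 0 1 ∩ Metric.closedBall b' 1)
      = Metric.closedBall 0 1 ∩ Metric.closedBall b 1 := by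
    ext x
    rw [Set.mem_preimage, Set.mem_inter_iff, Set.mem_inter_iff]
    simp only [Metric.mem_closedBall]
    rw [← hU, U.dist_map, dist_zero_right, dist_zero_right, U.norm_map]
  rw [lensVol, lensVol, ← hpre, U.measurePreserving.measureReal_preimage
    (Metric.isClosed_closedBall.inter Metric.isClosed_closedBall).measurableSet.nullMeasurableSet]

/-- Splitting off the first coordinate. -/
def splitFirst (n : ℕ) (x : Euc (n + 1)) : ℝ × Euc n :=
  (x 0, WithLp.toLp 2 fun i => x i.succ)

lemma measurePreserving_splitFirst (n : ℕ) : MeasurePreserving (splitFirst n) := by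
  have h1 := PiLp.volume_preserving_ofLp (Fin (n + 1))
  have h2 := volume_preserving_piFinSuccAbove (fun _ : Fin (n + 1) => ℝ) 0
  have h3 : MeasurePreserving (Prod.map (id : ℝ → ℝ) (WithLp.toLp 2 : (Fin n → ℝ) → Euc n)) :=
    (MeasurePreserving.id volume).prod (PiLp.volume_preserving_toLp (Fin n))
  exact (h3.comp h2).comp h1

lemma norm_sq_eq_splitFirst {n : ℕ} (x : Euc (n + 1)) :
    ‖x‖ ^ 2 = (splitFirst n x).1 ^ 2 + ‖(splitFirst n x).2‖ ^ 2 := by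
  rw [EuclideanSpace.real_norm_sq_eq, EuclideanSpace.real_norm_sq_eq, Fin.sum_univ_succ]
  rfl

/-- The intersection of two unit balls in the coordinates of `splitFirst`. -/
def lensBody (n : ℕ) (t : ℝ) : Set (ℝ × Euc n) :=
  {p | p.1 ^ 2 + ‖p.2‖ ^ 2 ≤ 1 ∧ (p.1 - t) ^ 2 + ‖p.2‖ ^ 2 ≤ 1}

lemma measurableSet_lensBody (n : ℕ) (t : ℝ) : MeasurableSet (lensBody n t) := by
  rw [lensBody, Set.ofPred_and]
  refine IsClosed.measurableSet (IsClosed.inter (isClosed_le ?_ ?_) (isClosed_le ?_ ?_)) <;> fun_prop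

/-- Each section is a ball or empty. The indicator matters for `n = 0`: outside the interval the
radius is `√` of a negative number, hence `0`, but `0 ^ 0 = 1`. -/
lemma volume_section_lensBody (n : ℕ) {t : ℝ} (h0 : 0 ≤ t) (u : ℝ) :
    volume (Prod.mk u ⁻¹' lensBody n t) = ENNReal.ofReal
      ((Set.Icc (t - 1) 1).indicator (fun u => √(1 - max (u ^ 2) ((u - t) ^ 2)) ^ n * ballVol n) u)
      := by
  by_cases hu : u ∈ Set.Icc (t - 1) 1
  · have hm : 0 ≤ 1 - max (u ^ 2) ((u - t) ^ 2) := by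
      rw [sub_nonneg, max_le_iff]
      constructor <;> nlinarith [hu.1, hu.2]
    have : Prod.mk u ⁻¹' lensBody n t
        = Metric.closedBall (0 : Euc n) √(1 - max (u ^ 2) ((u - t) ^ 2)) := by
      ext y
      rw [mem_closedBall_zero_iff, Real.le_sqrt (norm_nonneg _) hm]
      simp only [Set.mem_preimage, lensBody, Set.mem_ofPred_eq]
      rw [le_sub_comm, max_le_iff]
      constructor
      · rintro ⟨h1, h2⟩; constructor <;> linarith
      · rintro ⟨h1, h2⟩; constructor <;> linarith
    rw [Set.indicator_of_mem hu, this, ← volume_real_closedBall 0 (Real.sqrt_nonneg _),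
      measureReal_def, ENNReal.ofReal_toReal (isCompact_closedBall _ _).measure_ne_top]
  · rw [Set.indicator_of_notMem hu, ENNReal.ofReal_zero]
    convert measure_empty (μ := (volume : Measure (Euc n)))
    rw [Set.eq_empty_iff_forall_notMem]
    rintro y ⟨h1, h2⟩
    refine hu ⟨?_, ?_⟩
    · simp only at h2; nlinarith [sq_nonneg ‖y‖]
    · simp only at h1; nlinarith [sq_nonneg ‖y‖]

lemma volume_lensBody (n : ℕ) {t : ℝ} (h0 : 0 ≤ t) (h2 : t ≤ 2) :
    volume.real (lensBody n t) = 2 * ballVol n * chordIntegral n t := by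
  have hc : Continuous fun u : ℝ => √(1 - max (u ^ 2) ((u - t) ^ 2)) ^ n * ballVol n := by fun_prop
  have hpos := ballVol_pos n
  have hi : Integrable ((Set.Icc (t - 1) 1).indicator
      (fun u => √(1 - max (u ^ 2) ((u - t) ^ 2)) ^ n * ballVol n)) :=
    (hc.continuousOn.integrableOn_compact isCompact_Icc).integrable_indicator measurableSet_Icc
  have hnn : ∀ u, 0 ≤ (Set.Icc (t - 1) 1).indicator
      (fun u => √(1 - max (u ^ 2) ((u - t) ^ 2)) ^ n * ballVol n) u :=
    fun u => Set.indicator_nonneg (fun _ _ => by positivity) u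
  rw [measureReal_def, Measure.volume_eq_prod, Measure.prod_apply (measurableSet_lensBody n t)]
  simp only [volume_section_lensBody n h0]
  rw [← ofReal_integral_eq_lintegral_ofReal hi (Eventually.of_forall hnn),
    ENNReal.toReal_ofReal (integral_nonneg hnn), integral_indicator measurableSet_Icc,
    integral_Icc_eq_integral_Ioc, ← intervalIntegral.integral_of_le (by linarith),
    -- The maximum switches at the mirror hyperplane `u = t / 2`; both halves contribute equally, by
    -- `u ↦ t - u`.
    ← intervalIntegral.integral_add_adjacent_intervals (b := t / 2)
      (hc.intervalIntegrable _ _) (hc.intervalIntegrable _ _)]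
  have e1 : ∫ u in (t - 1)..(t / 2), √(1 - max (u ^ 2) ((u - t) ^ 2)) ^ n * ballVol n
      = chordIntegral n t * ballVol n := by
    rw [chordIntegral, ← intervalIntegral.integral_mul_const]
    have := intervalIntegral.integral_comp_sub_left
      (fun u => √(1 - u ^ 2) ^ n * ballVol n) t (a := t - 1) (b := t / 2)
    rw [show t - (t - 1) = 1 by ring, show t - t / 2 = t / 2 by ring] at this
    rw [← this]
    refine intervalIntegral.integral_congr fun u hu => ?_
    rw [Set.uIcc_of_le (by linarith)] at hu
    rw [max_eq_right (by nlinarith [hu.2]), show (u - t) ^ 2 = (t - u) ^ 2 by ring]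
  have e2 : ∫ u in (t / 2)..1, √(1 - max (u ^ 2) ((u - t) ^ 2)) ^ n * ballVol n
      = chordIntegral n t * ballVol n := by
    rw [chordIntegral, ← intervalIntegral.integral_mul_const]
    refine intervalIntegral.integral_congr fun u hu => ?_
    rw [Set.uIcc_of_le (by linarith)] at hu
    rw [max_eq_left (by nlinarith [hu.1])]
  rw [e1, e2]
  ring

lemma lensVol_eq {n : ℕ} (b : Euc (n + 1)) (hb : ‖b‖ ≤ 2) :
    lensVol b = 2 * ballVol n * chordIntegral n ‖b‖ := by
  -- Only the norm matters, so `b` may be placed on the first axis.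
  have hn : ‖b‖ = ‖(EuclideanSpace.single 0 ‖b‖ : Euc (n + 1))‖ := by simp
  rw [lensVol_eq_of_norm_eq hn, ← volume_lensBody n (norm_nonneg b) hb,
    ← (measurePreserving_splitFirst n).measureReal_preimage
      (measurableSet_lensBody n _).nullMeasurableSet, lensVol]
  congr 1
  ext x
  rw [Set.mem_inter_iff, mem_closedBall_zero_iff, mem_closedBall_iff_norm,
    ← sq_le_one_iff₀ (norm_nonneg _), ← sq_le_one_iff₀ (norm_nonneg (x - _)),
    norm_sq_eq_splitFirst, norm_sq_eq_splitFirst]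
  have : splitFirst n (x - EuclideanSpace.single 0 ‖b‖)
      = ((splitFirst n x).1 - ‖b‖, (splitFirst n x).2) := by
    ext <;> simp [splitFirst]
  rw [this]
  rfl

/-- The pairs of points which together with the origin have pairwise distances at most one. -/
def pairBody (L : ℕ) : Set (Euc L × Euc L) := {p | ‖p.1‖ ≤ 1 ∧ ‖p.2‖ ≤ 1 ∧ ‖p.1 - p.2‖ ≤ 1}

/-- The moments of the first component over `pairBody`. -/
def pairMoment (L s : ℕ) : ℝ := ∫ p in pairBody L, ‖p.1‖ ^ s

lemma isClosed_pairBody (L : ℕ) : IsClosed (pairBody L) := by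
  rw [pairBody, Set.ofPred_and, Set.ofPred_and]
  refine IsClosed.inter (isClosed_le ?_ ?_) (IsClosed.inter (isClosed_le ?_ ?_)
    (isClosed_le ?_ ?_)) <;> fun_prop

lemma isCompact_pairBody (L : ℕ) : IsCompact (pairBody L) := by
  refine ((isCompact_closedBall (0 : Euc L) 1).prod
    (isCompact_closedBall (0 : Euc L) 1)).of_isClosed_subset (isClosed_pairBody L) fun p hp => ?_
  exact ⟨mem_closedBall_zero_iff.2 hp.1, mem_closedBall_zero_iff.2 hp.2.1⟩

lemma integral_radial (n : ℕ) (f : ℝ → ℝ) :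
    ∫ x : Euc (n + 1), (Set.Iic (1 : ℝ)).indicator f ‖x‖
      = (n + 1) * ballVol (n + 1) * ∫ t in (0 : ℝ)..1, t ^ n * f t := by
  rw [integral_fun_norm_addHaar volume, finrank_euclideanSpace_fin, ← ballVol_eq_ball, nsmul_eq_mul,
    smul_eq_mul, intervalIntegral.integral_of_le zero_le_one, mul_assoc]
  congr 2
  · push_cast; rfl
  · have : ∀ y : ℝ, y ^ (n + 1 - 1) • (Set.Iic (1 : ℝ)).indicator f y
        = (Set.Iic (1 : ℝ)).indicator (fun t => t ^ n * f t) y := fun y => by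
      by_cases hy : y ∈ Set.Iic (1 : ℝ)
      · simp [Set.indicator_of_mem hy]
      · simp [Set.indicator_of_notMem hy]
    simp only [this]
    rw [setIntegral_indicator measurableSet_Iic, Set.Ioi_inter_Iic]

/-- Given the first point `b` in the unit ball, the second ranges over the lens of `0` and `b`,
whose volume depends only on `‖b‖`. Fubini and polar coordinates do the rest. -/
lemma pairMoment_eq (n s : ℕ) :
    pairMoment (n + 1) s = (n + 1) * ballVol (n + 1) * (2 * ballVol n * radialMoment n s) := by
  have hm := (isClosed_pairBody (n + 1)).measurableSet
  have hi : Integrable ((pairBody (n + 1)).indicator fun p => ‖p.1‖ ^ s) :=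
    (ContinuousOn.integrableOn_compact (isCompact_pairBody _) (by fun_prop)).integrable_indicator hm
  rw [pairMoment, ← integral_indicator hm, Measure.volume_eq_prod, integral_prod _ hi]
  have hsec : ∀ b : Euc (n + 1), ∫ c, (pairBody (n + 1)).indicator (fun p => ‖p.1‖ ^ s) (b, c)
      = (Set.Iic (1 : ℝ)).indicator
        (fun t => t ^ s * (2 * ballVol n * chordIntegral n t)) ‖b‖ := by
    intro b
    by_cases hb : ‖b‖ ≤ 1
    · rw [Set.indicator_of_mem (Set.mem_Iic.2 hb), ← lensVol_eq b (by linarith), lensVol,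
        mul_comm, ← smul_eq_mul, ← setIntegral_const, ← integral_indicator
          (Metric.isClosed_closedBall.inter Metric.isClosed_closedBall).measurableSet]
      congr 1
      ext c
      refine Set.indicator_eq_indicator ?_ rfl
      rw [Set.mem_inter_iff, mem_closedBall_zero_iff, mem_closedBall_iff_norm']
      simp [pairBody, hb]
    · rw [Set.indicator_of_notMem (by simpa using hb)]
      refine integral_eq_zero_of_ae (Eventually.of_forall fun c => ?_)
      exact Set.indicator_of_notMem (fun h => hb h.1) _
  simp only [hsec]
  rw [integral_radial, radialMoment, ← intervalIntegral.integral_const_mul (2 * ballVol n)]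
  refine congrArg _ (intervalIntegral.integral_congr fun t _ => ?_)
  ring

lemma pairMoment_pos (n s : ℕ) : 0 < pairMoment (n + 1) s := by
  rw [pairMoment_eq]
  have := ballVol_pos n
  have := ballVol_pos (n + 1)
  have := radialMoment_pos n s
  positivity

/-! ### The second moment of the ball -/

lemma normSqPerDim_eq {L : ℕ} (x : Euc L) : normSqPerDim x = ‖x‖ ^ 2 / L := by
  rw [normSqPerDim, EuclideanSpace.real_norm_sq_eq]
  ring

lemma sphereG_eq (n : ℕ) : sphereG (n + 1)
    = ballVol (n + 1) ^ (-(2 / ((n + 1 : ℕ) : ℝ))) / (((n + 1 : ℕ) : ℝ) + 2) := by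
  have hpos := ballVol_pos (n + 1)
  have h : ∫ x in Metric.closedBall (0 : Euc (n + 1)) 1, normSqPerDim x
      = ballVol (n + 1) / (n + 1 + 2) := by
    rw [← integral_indicator Metric.isClosed_closedBall.measurableSet]
    have e : ∀ x : Euc (n + 1), (Metric.closedBall 0 1).indicator normSqPerDim x
        = (Set.Iic (1 : ℝ)).indicator (fun t => t ^ 2 / (n + 1)) ‖x‖ := fun x => by
      by_cases hx : ‖x‖ ≤ 1
      · rw [Set.indicator_of_mem (Set.mem_Iic.2 hx),
          Set.indicator_of_mem (mem_closedBall_zero_iff.2 hx), normSqPerDim_eq]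
        push_cast
        rfl
      · rw [Set.indicator_of_notMem (by simpa using hx),
          Set.indicator_of_notMem (by simpa using hx)]
    simp only [e]
    have e2 : ∀ t : ℝ, t ^ n * (t ^ 2 / ((n : ℝ) + 1)) = t ^ (n + 2) / (n + 1) := fun t => by ring
    simp only [integral_radial, e2]
    rw [intervalIntegral.integral_div, integral_pow]
    push_cast
    field_simp
    simp
    ring
  rw [sphereG, normalizedSecondMoment, h, ← ballVol, Real.rpow_add hpos, Real.rpow_one,
    Real.rpow_neg hpos.le]
  push_cast
  field_simp

/-! ### Asymptotic count of lattice pairs -/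

open scoped Pointwise

/-- The pairs of lattice points which together with the origin have pairwise distances at
most `R`. -/
def latticePairs {L : ℕ} (Λ : Submodule ℤ (Euc L)) (R : ℝ) : Set (Euc L × Euc L) :=
  {p | p.1 ∈ Λ ∧ p.2 ∈ Λ ∧ ‖p.1‖ ≤ R ∧ ‖p.2‖ ≤ R ∧ ‖p.1 - p.2‖ ≤ R}

/-- The pairs of lattice points which together with the origin have pairwise distances less
than `R`. -/
def openLatticePairs {L : ℕ} (Λ : Submodule ℤ (Euc L)) (R : ℝ) : Set (Euc L × Euc L) :=
  {p | p.1 ∈ Λ ∧ p.2 ∈ Λ ∧ ‖p.1‖ < R ∧ ‖p.2‖ < R ∧ ‖p.1 - p.2‖ < R}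

section

variable {L : ℕ} (Λ : Submodule ℤ (Euc L))

lemma latticePairs_subset_openLatticePairs {R R' : ℝ} (h : R < R') :
    latticePairs Λ R ⊆ openLatticePairs Λ R' :=
  fun _ ⟨h1, h2, h3, h4, h5⟩ => ⟨h1, h2, h3.trans_lt h, h4.trans_lt h, h5.trans_lt h⟩

lemma latticePairs_mono {R R' : ℝ} (h : R ≤ R') : latticePairs Λ R ⊆ latticePairs Λ R' :=
  fun _ ⟨h1, h2, h3, h4, h5⟩ => ⟨h1, h2, h3.trans h, h4.trans h, h5.trans h⟩

variable [DiscreteTopology Λ]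

lemma finite_latticePairs (R : ℝ) : (latticePairs Λ R).Finite := by
  have h : (Metric.closedBall (0 : Euc L) R ∩ Λ).Finite :=
    Metric.finite_isBounded_inter_isClosed DiscreteTopology.isDiscrete Metric.isBounded_closedBall
      (AddSubgroup.isClosed_of_discrete (H := Λ.toAddSubgroup))
  exact (h.prod h).subset fun p hp => ⟨⟨mem_closedBall_zero_iff.2 hp.2.2.1, hp.1⟩,
    ⟨mem_closedBall_zero_iff.2 hp.2.2.2.1, hp.2.1⟩⟩

variable [IsZLattice ℝ Λ]

/-- The index type of a `ℤ`-basis of a lattice. -/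
abbrev LatticeIndex := Module.Free.ChooseBasisIndex ℤ Λ

lemma card_latticeIndex : Fintype.card (LatticeIndex Λ) = L := by
  rw [← Module.finrank_eq_card_chooseBasisIndex, ZLattice.rank ℝ Λ, finrank_euclideanSpace_fin]

/-- An `ℝ`-basis of `ℝ^L` which is a `ℤ`-basis of the lattice. -/
def latticeBasis : Module.Basis (LatticeIndex Λ) ℝ (Euc L) :=
  (Module.Free.chooseBasis ℤ Λ).ofZLatticeBasis ℝ Λ

lemma mem_iff_latticeBasis_repr (x : Euc L) :
    x ∈ Λ ↔ ∀ i, (latticeBasis Λ).equivFun x i ∈ Set.range (algebraMap ℤ ℝ) := by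
  conv_lhs => rw [← (Module.Free.chooseBasis ℤ Λ).ofZLatticeBasis_span ℝ]
  rw [Module.Basis.mem_span_iff_repr_mem]
  rfl

/-- Coordinates of pairs of vectors with respect to a lattice basis. -/
def pairCoord : (LatticeIndex Λ ⊕ LatticeIndex Λ → ℝ) ≃ₗ[ℝ] Euc L × Euc L :=
  (LinearEquiv.sumArrowLequivProdArrow (LatticeIndex Λ) (LatticeIndex Λ) ℝ ℝ).trans
    ((latticeBasis Λ).equivFun.symm.prodCongr (latticeBasis Λ).equivFun.symm)

lemma continuous_pairCoord : Continuous (pairCoord Λ) :=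
  (pairCoord Λ).toLinearMap.continuous_of_finiteDimensional

lemma mem_span_iff_pairCoord (z : LatticeIndex Λ ⊕ LatticeIndex Λ → ℝ) :
    z ∈ Submodule.span ℤ (Set.range (Pi.basisFun ℝ (LatticeIndex Λ ⊕ LatticeIndex Λ)))
      ↔ (pairCoord Λ z).1 ∈ Λ ∧ (pairCoord Λ z).2 ∈ Λ := by
  have h1 : (latticeBasis Λ).equivFun (pairCoord Λ z).1 = fun i => z (Sum.inl i) :=
    (latticeBasis Λ).equivFun.apply_symm_apply _
  have h2 : (latticeBasis Λ).equivFun (pairCoord Λ z).2 = fun i => z (Sum.inr i) :=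
    (latticeBasis Λ).equivFun.apply_symm_apply _
  rw [Module.Basis.mem_span_iff_repr_mem, mem_iff_latticeBasis_repr, mem_iff_latticeBasis_repr,
    Sum.forall, h1, h2]
  rfl

lemma map_latticeBasis_volume :
    Measure.map (latticeBasis Λ).equivFun.symm volume
      = (ENNReal.ofReal (ZLattice.covolume Λ))⁻¹ • (volume : Measure (Euc L)) := by
  have hc : Continuous (latticeBasis Λ).equivFun.symm :=
    (latticeBasis Λ).equivFun.symm.toLinearMap.continuous_of_finiteDimensional
  ext s hs
  rw [Measure.map_apply hc.measurable hs, Measure.smul_apply, smul_eq_mul, mul_comm,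
    ← div_eq_mul_inv, ← ZLattice.volume_image_eq_volume_div_covolume' Λ
      (Module.Free.chooseBasis ℤ Λ) hs.nullMeasurableSet]
  congr 1
  exact ((latticeBasis Λ).equivFun.image_eq_preimage_symm s).symm

/-- Each of the two components contributes one factor `1 / covolume`. -/
lemma map_pairCoord_volume :
    Measure.map (pairCoord Λ) volume
      = ((ENNReal.ofReal (ZLattice.covolume Λ))⁻¹ * (ENNReal.ofReal (ZLattice.covolume Λ))⁻¹) •
        (volume : Measure (Euc L × Euc L)) := by
  have hc : Continuous (latticeBasis Λ).equivFun.symm :=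
    (latticeBasis Λ).equivFun.symm.toLinearMap.continuous_of_finiteDimensional
  have hmp := volume_measurePreserving_sumPiEquivProdPi
    (fun _ : LatticeIndex Λ ⊕ LatticeIndex Λ => ℝ)
  have e : ⇑(pairCoord Λ) = Prod.map (latticeBasis Λ).equivFun.symm (latticeBasis Λ).equivFun.symm ∘
    (MeasurableEquiv.sumPiEquivProdPi fun _ : LatticeIndex Λ ⊕ LatticeIndex Λ => ℝ) := rfl
  have hne : (ENNReal.ofReal (ZLattice.covolume Λ))⁻¹ ≠ ⊤ := by
    simpa using ZLattice.covolume_pos Λ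
  rw [e, ← Measure.map_map (hc.measurable.prodMap hc.measurable) hmp.measurable, hmp.map_eq,
    Measure.volume_eq_prod, ← Measure.map_prod_map _ _ hc.measurable hc.measurable,
    map_latticeBasis_volume, Measure.prod_smul_left, Measure.prod_smul_right, smul_smul,
    Measure.volume_eq_prod]

/-- The preimage of `pairBody` in lattice coordinates. -/
def coordBody : Set (LatticeIndex Λ ⊕ LatticeIndex Λ → ℝ) := pairCoord Λ ⁻¹' pairBody L

lemma integral_coordBody (k : ℕ) :
    ∫ z in coordBody Λ, ‖(pairCoord Λ z).1‖ ^ k = pairMoment L k / ZLattice.covolume Λ ^ 2 := by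
  have hcont : Continuous fun p : Euc L × Euc L => ‖p.1‖ ^ k := by fun_prop
  have h := setIntegral_map (μ := volume) (g := pairCoord Λ) (isClosed_pairBody L).measurableSet
    hcont.aestronglyMeasurable (continuous_pairCoord Λ).aemeasurable
  have hpos := ZLattice.covolume_pos Λ
  rw [coordBody, ← h, map_pairCoord_volume, Measure.restrict_smul, integral_smul_measure,
    ENNReal.toReal_mul, ENNReal.toReal_inv, ENNReal.toReal_ofReal hpos.le, smul_eq_mul, pairMoment]
  field_simp

lemma isBounded_coordBody : Bornology.IsBounded (coordBody Λ) := by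
  have hc : Continuous (pairCoord Λ).symm :=
    (pairCoord Λ).symm.toLinearMap.continuous_of_finiteDimensional
  have : coordBody Λ = (pairCoord Λ).symm '' pairBody L := by
    rw [(pairCoord Λ).symm.image_eq_preimage_symm]; rfl
  rw [this]
  exact ((isCompact_pairBody L).image hc).isBounded

lemma isClosed_coordBody : IsClosed (coordBody Λ) :=
  (isClosed_pairBody L).preimage (continuous_pairCoord Λ)

/-- Convexity makes the frontier a null set, as the convergence of the Riemann sums requires. -/
lemma convex_pairBody : Convex ℝ (pairBody L) := by
  have h1 : Convex ℝ ((LinearMap.fst ℝ (Euc L) (Euc L)) ⁻¹' Metric.closedBall 0 1) :=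
    (convex_closedBall _ _).linear_preimage _
  have h2 : Convex ℝ ((LinearMap.snd ℝ (Euc L) (Euc L)) ⁻¹' Metric.closedBall 0 1) :=
    (convex_closedBall _ _).linear_preimage _
  have h3 : Convex ℝ ((LinearMap.fst ℝ (Euc L) (Euc L) - LinearMap.snd ℝ (Euc L) (Euc L)) ⁻¹'
      Metric.closedBall 0 1) :=
    (convex_closedBall _ _).linear_preimage _
  convert h1.inter (h2.inter h3) using 1
  ext p
  simp [pairBody]

lemma volume_frontier_coordBody : volume (frontier (coordBody Λ)) = 0 :=
  Convex.addHaar_frontier volume (convex_pairBody.linear_preimage (pairCoord Λ).toLinearMap)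

/-- The sum of `‖p.1‖ ^ k` over all lattice pairs of radius `R`. -/
def latticePairSum (k : ℕ) (R : ℝ) : ℝ := ∑ p ∈ (finite_latticePairs Λ R).toFinset, ‖p.1‖ ^ k

/-- Scaling by `n` carries the grid of mesh `1 / n` in `coordBody` to the lattice pairs of radius
`n`; the summand is homogeneous of degree `k`. -/
lemma tsum_coordBody {n : ℕ} (hn : 0 < n) (k : ℕ) :
    ∑' x : ↑(coordBody Λ ∩ (n : ℝ)⁻¹ • (Submodule.span ℤ (Set.range
      (Pi.basisFun ℝ (LatticeIndex Λ ⊕ LatticeIndex Λ))) : Set _)), ‖(pairCoord Λ x).1‖ ^ k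
      = latticePairSum Λ k n / (n : ℝ) ^ k := by
  have hn' : (0 : ℝ) < n := by exact_mod_cast hn
  have hmem : ∀ x, x ∈ coordBody Λ ∩ (n : ℝ)⁻¹ • (Submodule.span ℤ (Set.range
      (Pi.basisFun ℝ (LatticeIndex Λ ⊕ LatticeIndex Λ))) : Set _) ↔
      ((pairCoord Λ).toEquiv.trans (Equiv.smulRight hn'.ne')) x
        ∈ (finite_latticePairs Λ n).toFinset := by
    intro x
    rw [Set.mem_inter_iff, Set.mem_inv_smul_set_iff₀ hn'.ne', SetLike.mem_coe,
      mem_span_iff_pairCoord, map_smul, Set.Finite.mem_toFinset]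
    simp only [coordBody, pairBody, latticePairs, Set.mem_preimage, Set.mem_ofPred_eq,
      Equiv.trans_apply, LinearEquiv.coe_toEquiv, Equiv.smulRight_apply, Prod.smul_fst,
      Prod.smul_snd, ← smul_sub, norm_smul, Real.norm_natCast]
    rw [mul_le_iff_le_one_right hn', mul_le_iff_le_one_right hn', mul_le_iff_le_one_right hn']
    tauto
  rw [latticePairSum, ← Finset.tsum_subtype, ← tsum_div_const,
    ← (((pairCoord Λ).toEquiv.trans (Equiv.smulRight hn'.ne')).subtypeEquiv hmem).tsum_eq]
  refine tsum_congr fun x => ?_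
  simp [norm_smul, mul_pow]
  field_simp

lemma tendsto_latticePairSum_natCast (k : ℕ) :
    Tendsto (fun n : ℕ => latticePairSum Λ k n / (n : ℝ) ^ (2 * L + k)) atTop
      (𝓝 (pairMoment L k / ZLattice.covolume Λ ^ 2)) := by
  have hc : Continuous fun z => ‖(pairCoord Λ z).1‖ ^ k :=
    ((continuous_pairCoord Λ).fst.norm).pow k
  have h := tendsto_tsum_div_pow_atTop_integral (coordBody Λ) _ hc (isBounded_coordBody Λ)
    (isClosed_coordBody Λ).measurableSet (volume_frontier_coordBody Λ)
  rw [integral_coordBody] at h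
  refine h.congr' ?_
  filter_upwards [eventually_gt_atTop 0] with n hn
  rw [tsum_coordBody Λ hn, Fintype.card_sum, card_latticeIndex, div_div, ← pow_add]
  ring_nf

/-- Sums over lattice pairs are asymptotic to the moments of `pairBody`, whichever of the
boundary pairs are taken into account. -/
lemma sum_latticePairs_asymptotic (k : ℕ) {ε : ℝ} (hε : 0 < ε) :
    ∃ R₀ : ℝ, ∀ R, R₀ ≤ R → ∀ P : Finset (Euc L × Euc L), openLatticePairs Λ R ⊆ P →
      (P : Set (Euc L × Euc L)) ⊆ latticePairs Λ R →
      |(∑ p ∈ P, ‖p.1‖ ^ k) / R ^ (2 * L + k) - pairMoment L k / ZLattice.covolume Λ ^ 2| < ε := by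
  set C := pairMoment L k / ZLattice.covolume Λ ^ 2
  have h1 : Tendsto (fun R : ℝ => latticePairSum Λ k (⌈R⌉₊ : ℕ) / R ^ (2 * L + k)) atTop
      (𝓝 C) := by
    have ha := (tendsto_latticePairSum_natCast Λ k).comp
      (tendsto_nat_ceil_atTop (α := ℝ))
    have hb := (tendsto_nat_ceil_div_atTop (R := ℝ)).pow (2 * L + k)
    have := ha.mul hb
    rw [one_pow, mul_one] at this
    refine this.congr' ?_
    filter_upwards [eventually_gt_atTop 0] with R hR
    have : (0 : ℝ) < (⌈R⌉₊ : ℕ) := by exact_mod_cast Nat.ceil_pos.2 hR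
    simp only [Function.comp, div_pow]
    field_simp
  -- For the lower bound the radius `⌈R⌉₊ - 1` is strictly less than `R`, so its closed pairs are
  -- open pairs of radius `R`. The floor would fail at integers.
  have h2 : Tendsto (fun R : ℝ => latticePairSum Λ k ((⌈R⌉₊ - 1 : ℕ) : ℕ) / R ^ (2 * L + k)) atTop
      (𝓝 C) := by
    have ht : Tendsto (fun R : ℝ => ⌈R⌉₊ - 1) atTop atTop :=
      (tendsto_sub_atTop_nat 1).comp tendsto_nat_ceil_atTop
    have ha := (tendsto_latticePairSum_natCast Λ k).comp ht
    have hb : Tendsto (fun R : ℝ => (((⌈R⌉₊ - 1 : ℕ) : ℕ) : ℝ) / R) atTop (𝓝 1) := by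
      have := (tendsto_nat_ceil_div_atTop (R := ℝ)).sub tendsto_inv_atTop_zero
      rw [sub_zero] at this
      refine this.congr' ?_
      filter_upwards [eventually_gt_atTop 0] with R hR
      rw [Nat.cast_sub (Nat.ceil_pos.2 hR)]
      push_cast
      ring
    have := ha.mul (hb.pow (2 * L + k))
    rw [one_pow, mul_one] at this
    refine this.congr' ?_
    filter_upwards [ht.eventually_gt_atTop 0] with R hR
    have : (0 : ℝ) < ((⌈R⌉₊ - 1 : ℕ) : ℕ) := by exact_mod_cast hR
    simp only [Function.comp, div_pow]
    field_simp
  have hev := ((h1.eventually (gt_mem_nhds (show C < C + ε by linarith))).and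
    (h2.eventually (lt_mem_nhds (show C - ε < C by linarith)))).and (eventually_gt_atTop (0 : ℝ))
  obtain ⟨R₀, hR₀⟩ := eventually_atTop.1 hev
  refine ⟨R₀, fun R hR P hP1 hP2 => ?_⟩
  obtain ⟨⟨ha, hb⟩, hpos⟩ := hR₀ R hR
  have hle : (∑ p ∈ P, ‖p.1‖ ^ k) ≤ latticePairSum Λ k (⌈R⌉₊ : ℕ) := by
    refine Finset.sum_le_sum_of_subset_of_nonneg (fun p hp => ?_) fun _ _ _ => by positivity
    rw [Set.Finite.mem_toFinset]
    exact latticePairs_mono Λ (Nat.le_ceil R) (hP2 hp)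
  have hge : latticePairSum Λ k ((⌈R⌉₊ - 1 : ℕ) : ℕ) ≤ ∑ p ∈ P, ‖p.1‖ ^ k := by
    refine Finset.sum_le_sum_of_subset_of_nonneg (fun p hp => ?_) fun _ _ _ => by positivity
    rw [Set.Finite.mem_toFinset] at hp
    refine hP1 (latticePairs_subset_openLatticePairs Λ ?_ hp)
    exact Nat.lt_ceil.1 (Nat.sub_lt (Nat.ceil_pos.2 hpos) one_pos)
  rw [abs_lt]
  constructor
  · have := div_le_div_of_nonneg_right hge (pow_pos hpos (2 * L + k)).le
    linarith
  · have := div_le_div_of_nonneg_right hle (pow_pos hpos (2 * L + k)).le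
    linarith

end

/-! ### Covolumes of similar lattices -/

section Similarity

variable {L : ℕ}

lemma GeomSimilar.trans {Λ M M' : Submodule ℤ (Euc L)} (h : GeomSimilar Λ M)
    (h' : GeomSimilar M M') : GeomSimilar Λ M' := by
  obtain ⟨c, U, hc, hU⟩ := h
  obtain ⟨c', U', hc', hU'⟩ := h'
  refine ⟨c' * c, U.trans U', mul_pos hc' hc, fun x => ?_⟩
  rw [hU']
  constructor
  · rintro ⟨y, hy, rfl⟩
    obtain ⟨z, hz, rfl⟩ := (hU y).1 hy
    exact ⟨z, hz, by simp [mul_smul]⟩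
  · rintro ⟨z, hz, rfl⟩
    exact ⟨c • U z, (hU _).2 ⟨z, hz, rfl⟩, by simp [mul_smul]⟩

/-- The similarity `x ↦ c U x`. -/
def similarity {c : ℝ} (hc : 0 < c) (U : Euc L ≃ₗᵢ[ℝ] Euc L) : Euc L ≃L[ℝ] Euc L :=
  U.toContinuousLinearEquiv.trans (ContinuousLinearEquiv.smulLeft (Units.mk0 c hc.ne'))

lemma similarity_apply {c : ℝ} (hc : 0 < c) (U : Euc L ≃ₗᵢ[ℝ] Euc L) (x : Euc L) :
    similarity hc U x = c • U x := rfl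

/-- In this form `M` inherits the lattice instances and a transported basis from `Λ`. -/
lemma eq_comap_similarity {Λ M : Submodule ℤ (Euc L)} {c : ℝ} (hc : 0 < c)
    {U : Euc L ≃ₗᵢ[ℝ] Euc L} (h : ∀ x, x ∈ M ↔ ∃ y ∈ Λ, x = c • U y) :
    M = ZLattice.comap ℝ Λ (similarity hc U).symm.toLinearMap := by
  ext x
  rw [h, ZLattice.comap, Submodule.mem_comap]
  constructor
  · rintro ⟨y, hy, rfl⟩
    rw [← similarity_apply hc U]
    simpa using hy
  · intro hx
    refine ⟨_, hx, ?_⟩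
    rw [← similarity_apply hc U]
    simp

lemma volume_real_image_similarity {c : ℝ} (hc : 0 < c) (U : Euc L ≃ₗᵢ[ℝ] Euc L)
    (s : Set (Euc L)) : volume.real (similarity hc U '' s) = c ^ L * volume.real s := by
  have h : similarity hc U '' s = c • (U '' s) := by
    rw [← Set.image_smul, Set.image_image]
    rfl
  rw [h, measureReal_def, Measure.addHaar_smul, finrank_euclideanSpace_fin, ENNReal.toReal_mul,
    ENNReal.toReal_ofReal (abs_nonneg _), abs_of_pos (pow_pos hc L), U.image_eq_preimage_symm]
  have hU : MeasurePreserving U.symm.toMeasurableEquiv := U.symm.measurePreserving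
  exact congrArg (fun a => c ^ L * ENNReal.toReal a) (hU.measure_preimage_equiv s)

variable {Λ M : Submodule ℤ (Euc L)} [DiscreteTopology Λ] [IsZLattice ℝ Λ]

lemma covolume_similar {c : ℝ} (hc : 0 < c)
    {U : Euc L ≃ₗᵢ[ℝ] Euc L} (h : ∀ x, x ∈ M ↔ ∃ y ∈ Λ, x = c • U y) :
    ZLattice.covolume M = c ^ L * ZLattice.covolume Λ := by
  rw [eq_comap_similarity hc h]
  let b := Module.Free.chooseBasis ℤ Λ
  rw [ZLattice.covolume_eq_measure_fundamentalDomain _ _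
      (ZLattice.isAddFundamentalDomain b volume),
    ZLattice.covolume_eq_measure_fundamentalDomain _ _ (ZLattice.isAddFundamentalDomain
      (b.ofZLatticeComap ℝ Λ (similarity hc U).symm.toLinearEquiv) volume),
    ← volume_real_image_similarity hc U, ← (similarity hc U).coe_toLinearEquiv,
    ZSpan.map_fundamentalDomain]
  congr!
  ext1 i
  rw [Module.Basis.map_apply]
  refine (Module.Basis.ofZLatticeBasis_apply ..).trans ?_
  refine (Module.Basis.ofZLatticeComap_apply ..).trans ?_
  rw [Module.Basis.ofZLatticeBasis_apply]
  rfl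

lemma GeomSimilar.isZLattice (h : GeomSimilar Λ M) :
    ∃ _ : DiscreteTopology M, IsZLattice ℝ M := by
  obtain ⟨c, U, hc, hU⟩ := h
  rw [eq_comap_similarity hc hU]
  exact ⟨inferInstance, inferInstance⟩

end Similarity

/-! ### Systems of representatives -/

section Representatives

variable {E : Type*} [AddCommGroup E] {A B : Submodule ℤ E}

/-- `T` is a system of representatives of `B` modulo `A`. -/
def IsReprSystem (A B : Submodule ℤ E) (T : Finset B) : Prop :=
  ∀ b : B, ∃! d : B, d ∈ T ∧ (b : E) - d ∈ A

lemma IsReprSystem.card_eq {T : Finset B} (hT : IsReprSystem A B T) :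
    T.card = A.toAddSubgroup.relIndex B.toAddSubgroup := by
  classical
  have h : Function.Bijective fun d : T => (Submodule.Quotient.mk d.1 : B ⧸ A.submoduleOf B) := by
    constructor
    · intro d d' hdd
      have h1 : (d.1 : E) - d'.1 ∈ A := (Submodule.Quotient.eq (A.submoduleOf B)).1 hdd
      obtain ⟨e, -, he⟩ := hT d.1
      have h2 := he d.1 ⟨d.2, by simp⟩
      have h3 := he d'.1 ⟨d'.2, h1⟩
      exact Subtype.ext (h2.trans h3.symm)
    · intro q
      obtain ⟨b, rfl⟩ := Submodule.Quotient.mk_surjective _ q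
      obtain ⟨d, ⟨hd, hbd⟩, -⟩ := hT b
      exact ⟨⟨d, hd⟩, ((Submodule.Quotient.eq (A.submoduleOf B)).2 hbd).symm⟩
  have h2 := Nat.card_congr (Equiv.ofBijective _ h)
  rw [Nat.card_eq_fintype_card, Fintype.card_coe] at h2
  exact h2

lemma exists_isReprSystem (h : A.toAddSubgroup.relIndex B.toAddSubgroup ≠ 0) :
    ∃ T : Finset B, IsReprSystem A B T := by
  classical
  have hfin : Finite (B ⧸ A.submoduleOf B) := Nat.finite_of_card_ne_zero h
  have := Fintype.ofFinite (B ⧸ A.submoduleOf B)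
  refine ⟨Finset.univ.image (Quotient.out : B ⧸ A.submoduleOf B → B), fun b => ?_⟩
  have hout : ∀ q : B ⧸ A.submoduleOf B, Submodule.Quotient.mk q.out = q := fun q => Quotient.out_eq q
  refine ⟨(Submodule.Quotient.mk b : B ⧸ A.submoduleOf B).out, ⟨by simp, ?_⟩, ?_⟩
  · exact (Submodule.Quotient.eq (A.submoduleOf B)).1 (hout _).symm
  · rintro d ⟨hd, hbd⟩
    obtain ⟨q, -, rfl⟩ := Finset.mem_image.1 hd
    have : (Submodule.Quotient.mk b : B ⧸ A.submoduleOf B) = Submodule.Quotient.mk q.out :=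
      (Submodule.Quotient.eq (A.submoduleOf B)).2 hbd
    rw [this, hout]

lemma IsReprSystem.sum_eq {T T' : Finset B} (hT : IsReprSystem A B T) (hT' : IsReprSystem A B T')
    {f : B → ℝ} (hf : ∀ b b' : B, (b : E) - b' ∈ A → f b = f b') :
    ∑ b ∈ T, f b = ∑ b ∈ T', f b := by
  choose g hg hgu using fun b => (hT' b)
  choose g' hg' hgu' using fun b => (hT b)
  refine Finset.sum_bij' (fun b _ => g b) (fun b _ => g' b) (fun b _ => (hg b).1)
    (fun b _ => (hg' b).1) (fun b hb => ?_) (fun b hb => ?_) fun b _ => hf _ _ (hg b).2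
  · exact (hgu' (g b) b ⟨hb, by simpa using A.neg_mem (hg b).2⟩).symm
  · exact (hgu (g' b) b ⟨hb, by simpa using A.neg_mem (hg' b).2⟩).symm

end Representatives

/-! ### Fibers of the labeling as sets of lattice pairs -/

namespace MDQuantizer

section Cells

variable {K L : ℕ} {Λ : Submodule ℤ (Euc L)} (S : MDQuantizer K L Λ)

lemma p_le_c : S.Λp ≤ S.Λc := S.p_le_s.trans S.s_le_c

lemma isReprSystem_cell : IsReprSystem S.Λp S.Λc S.cell := S.cell_repr

lemma card_cell : S.cell.card = S.N ^ 2 := by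
  rw [S.isReprSystem_cell.card_eq,
    ← AddSubgroup.relIndex_mul_relIndex S.Λp.toAddSubgroup S.Λs.toAddSubgroup S.Λc.toAddSubgroup
      S.p_le_s S.s_le_c, S.index_p, S.index_s, sq]

/-- The central lattice points whose `i`-th label is `x`. -/
def fiber (i : Fin K) (x : S.Λs) : Set S.Λc := {c | S.α c i = x}

/-- Each central point has exactly one translate by `Λp` whose `i`-th label lies in the
representative system `X`, so the fibers over `X` replace the Voronoi cell for periodic `f`. With `f
= 1` the average fiber size comes out as `N ^ 2 / N = N`. -/
lemma exists_sum_cell_eq (hfin : ∀ i x, (S.fiber i x).Finite) (i : Fin K) :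
    ∃ X : Finset S.Λs, X.card = S.N ∧ ∀ f : S.Λc → ℝ,
      (∀ c c' : S.Λc, (c : Euc L) - c' ∈ S.Λp → f c = f c') →
      ∑ c ∈ S.cell, f c = ∑ x ∈ X, ∑ c ∈ (hfin i x).toFinset, f c := by
  classical
  have hN : S.Λp.toAddSubgroup.relIndex S.Λs.toAddSubgroup ≠ 0 := by
    rw [S.index_p]; exact S.N_pos.ne'
  obtain ⟨X, hX⟩ := exists_isReprSystem hN
  refine ⟨X, by rw [hX.card_eq, S.index_p], fun f hf => ?_⟩
  rw [← Finset.sum_biUnion]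
  · refine S.isReprSystem_cell.sum_eq (fun c => ?_) hf
    obtain ⟨x, ⟨hx, hcx⟩, hu⟩ := hX (S.α c i)
    have hmem : (c : Euc L) - ((S.α c i : Euc L) - x) ∈ S.Λc :=
      S.Λc.sub_mem c.2 (S.p_le_c hcx)
    refine ⟨⟨_, hmem⟩, ⟨?_, by simpa using hcx⟩, ?_⟩
    · rw [Finset.mem_biUnion]
      refine ⟨x, hx, ?_⟩
      rw [Set.Finite.mem_toFinset]
      have := S.α_shift c ⟨_, hmem⟩ (-((S.α c i : Euc L) - x)) (S.Λp.neg_mem hcx)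
        (sub_eq_add_neg _ _) i
      exact Subtype.ext (by rw [this]; abel)
    · rintro d ⟨hd, hcd⟩
      obtain ⟨x', hx', hdx'⟩ := Finset.mem_biUnion.1 hd
      rw [Set.Finite.mem_toFinset] at hdx'
      have hsh := S.α_shift d c _ hcd (by abel) i
      rw [show S.α d i = x' from hdx'] at hsh
      have hxx : x' = x := hu x' ⟨hx', by rw [hsh]; simpa using hcd⟩
      refine Subtype.ext ?_
      change (d : Euc L) = c - ((S.α c i : Euc L) - x)
      rw [hsh, hxx]
      abel
  · intro x _ x' _ hne
    refine Finset.disjoint_left.2 fun c hc hc' => hne ?_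
    rw [Set.Finite.mem_toFinset] at hc hc'
    exact (show S.α c i = x from hc).symm.trans hc'

lemma normSqPerDim_sub_eq_of_mem (i j : Fin K) (c c' : S.Λc) (h : (c : Euc L) - c' ∈ S.Λp) :
    normSqPerDim ((S.α c i : Euc L) - (S.α c j : Euc L))
      = normSqPerDim ((S.α c' i : Euc L) - (S.α c' j : Euc L)) := by
  rw [S.α_shift c' c _ h (by abel) i, S.α_shift c' c _ h (by abel) j, add_sub_add_right_eq_sub]

/-- Finiteness of the fiber ensures that the `finsum` does not take its default value `0`. -/
lemma pairSum_eq_sum (hfin : ∀ i x, (S.fiber i x).Finite) (i j : Fin K) (x : S.Λs) :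
    S.pairSum i j x
      = ∑ c ∈ (hfin i x).toFinset, normSqPerDim ((S.α c i : Euc L) - (S.α c j : Euc L)) := by
  refine (finsum_mem_eq_finite_toFinset_sum _ (hfin i x)).trans ?_
  refine Finset.sum_congr rfl fun c hc => ?_
  rw [Set.Finite.mem_toFinset] at hc
  rw [show S.α c i = x from hc]

end Cells

section ThreeChannels

variable {L : ℕ} {Λ : Submodule ℤ (Euc L)} (S : MDQuantizer 3 L Λ)

/-- The differences of the labels `j`, `k` to the label `i`, pulled back to the lattice `Λ`. -/
def labelPair (c : ℝ) (U : Euc L ≃ₗᵢ[ℝ] Euc L) (i j k : Fin 3) (d : S.Λc) : Euc L × Euc L :=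
  (c⁻¹ • U.symm ((S.α d j : Euc L) - S.α d i), c⁻¹ • U.symm ((S.α d k : Euc L) - S.α d i))

lemma inv_smul_symm_mem {c : ℝ} (hc : 0 < c) {U : Euc L ≃ₗᵢ[ℝ] Euc L}
    (hU : ∀ x, x ∈ S.Λs ↔ ∃ y ∈ Λ, x = c • U y) {x : Euc L} (hx : x ∈ S.Λs) :
    c⁻¹ • U.symm x ∈ Λ := by
  obtain ⟨y, hy, rfl⟩ := (hU x).1 hx
  simpa [smul_smul, hc.ne'] using hy

lemma norm_inv_smul_symm {c : ℝ} (hc : 0 < c) (U : Euc L ≃ₗᵢ[ℝ] Euc L) (x : Euc L) :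
    ‖c⁻¹ • U.symm x‖ = ‖x‖ / c := by
  rw [norm_smul, U.symm.norm_map, Real.norm_of_nonneg (inv_nonneg.2 hc.le), div_eq_inv_mul]

lemma labelPair_mem {c : ℝ} (hc : 0 < c) {U : Euc L ≃ₗᵢ[ℝ] Euc L}
    (hU : ∀ x, x ∈ S.Λs ↔ ∃ y ∈ Λ, x = c • U y) (i j k : Fin 3) (d : S.Λc) :
    S.labelPair c U i j k d ∈ latticePairs Λ (S.r / c) := by
  refine ⟨S.inv_smul_symm_mem hc hU (S.Λs.sub_mem (S.α d j).2 (S.α d i).2),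
    S.inv_smul_symm_mem hc hU (S.Λs.sub_mem (S.α d k).2 (S.α d i).2), ?_, ?_, ?_⟩
  · rw [labelPair, norm_inv_smul_symm hc]
    exact div_le_div_of_nonneg_right (S.tuples_le d j i) hc.le
  · rw [labelPair, norm_inv_smul_symm hc]
    exact div_le_div_of_nonneg_right (S.tuples_le d k i) hc.le
  · rw [labelPair, ← smul_sub, ← map_sub, norm_inv_smul_symm hc, sub_sub_sub_cancel_right]
    exact div_le_div_of_nonneg_right (S.tuples_le d j k) hc.le

/-- Within a fiber the label `x` is known, so the two differences recover the whole triple, and `α`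
is injective. -/
lemma labelPair_injOn {c : ℝ} (hc : 0 < c) (U : Euc L ≃ₗᵢ[ℝ] Euc L) {i j k : Fin 3}
    (hi : ∀ l, l = i ∨ l = j ∨ l = k) (x : S.Λs) :
    Set.InjOn (S.labelPair c U i j k) (S.fiber i x) := by
  intro d hd d' hd' h
  have hinj : ∀ {y z : Euc L}, c⁻¹ • U.symm y = c⁻¹ • U.symm z → y = z := fun h =>
    U.symm.injective (smul_right_injective _ (inv_ne_zero hc.ne') h)
  have h1 := hinj (congrArg Prod.fst h)
  have h2 := hinj (congrArg Prod.snd h)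
  have h0 : S.α d i = S.α d' i := (show S.α d i = x from hd).trans (show S.α d' i = x from hd').symm
  rw [h0, sub_left_inj] at h1 h2
  refine S.α_injective (funext fun l => ?_)
  rcases hi l with rfl | rfl | rfl
  · exact h0
  · exact Subtype.ext h1
  · exact Subtype.ext h2

lemma exists_labelPair_eq {c : ℝ} (hc : 0 < c) {U : Euc L ≃ₗᵢ[ℝ] Euc L}
    (hU : ∀ x, x ∈ S.Λs ↔ ∃ y ∈ Λ, x = c • U y) {i j k : Fin 3}
    (hij : j ≠ i) (hik : k ≠ i) (hjk : k ≠ j) (hi : ∀ l, l = i ∨ l = j ∨ l = k) (x : S.Λs)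
    {p : Euc L × Euc L} (hp : p ∈ openLatticePairs Λ (S.r / c)) :
    ∃ d ∈ S.fiber i x, S.labelPair c U i j k d = p := by
  obtain ⟨h1, h2, h3, h4, h5⟩ := hp
  have hnorm : ∀ y : Euc L, ‖y‖ < S.r / c → ‖c • U y‖ < S.r := fun y hy => by
    rw [norm_smul, U.norm_map, Real.norm_of_nonneg hc.le, mul_comm]
    exact (lt_div_iff₀ hc).1 hy
  -- Needed for the pairs `l = m`: the distance `0` must also be strictly less than `r`.
  have hr : 0 < S.r := (norm_nonneg _).trans_lt (hnorm _ h3)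
  have hmem : ∀ y ∈ Λ, (x : Euc L) + c • U y ∈ S.Λs := fun y hy =>
    S.Λs.add_mem x.2 ((hU _).2 ⟨y, hy, rfl⟩)
  let t : Fin 3 → S.Λs := fun l =>
    if l = i then x else if l = j then ⟨_, hmem _ h1⟩ else ⟨_, hmem _ h2⟩
  have ti : t i = x := by simp [t]
  have tj : (t j : Euc L) = x + c • U p.1 := by simp [t, hij]
  have tk : (t k : Euc L) = x + c • U p.2 := by simp [t, hik, hjk]
  have n1 := hnorm _ h3
  have n2 := hnorm _ h4
  have n3 := hnorm _ h5
  have hlt : ∀ l m, ‖(t l : Euc L) - (t m : Euc L)‖ < S.r := by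
    have s1 : ‖(t j : Euc L) - (t i : Euc L)‖ < S.r := by rwa [ti, tj, add_sub_cancel_left]
    have s2 : ‖(t k : Euc L) - (t i : Euc L)‖ < S.r := by rwa [ti, tk, add_sub_cancel_left]
    have s3 : ‖(t j : Euc L) - (t k : Euc L)‖ < S.r := by
      rwa [tj, tk, add_sub_add_left_eq_sub, ← smul_sub, ← map_sub]
    intro l m
    rcases hi l with rfl | rfl | rfl <;> rcases hi m with rfl | rfl | rfl <;>
      first
        | (rw [sub_self, norm_zero]; exact hr)
        | assumption
        | (rw [norm_sub_rev]; assumption)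
  obtain ⟨d, hd⟩ := S.tuples_lt t hlt
  refine ⟨d, ?_, ?_⟩
  · change S.α d i = x
    rw [hd, ti]
  · rw [labelPair, hd, ti, tj, tk, add_sub_cancel_left, add_sub_cancel_left]
    simp [smul_smul, hc.ne']

variable [DiscreteTopology Λ]

lemma finite_fiber (i : Fin 3) (x : S.Λs) : (S.fiber i x).Finite := by
  obtain ⟨c, U, hc, hU⟩ := S.similar_c.trans S.similar_s
  obtain ⟨j, k, hi⟩ : ∃ j k : Fin 3, ∀ l, l = i ∨ l = j ∨ l = k := by
    revert i; decide
  exact Set.Finite.of_finite_image ((finite_latticePairs Λ (S.r / c)).subset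
    (Set.image_subset_iff.2 fun d _ => S.labelPair_mem hc hU i j k d))
    (S.labelPair_injOn hc U hi x)

/-- The labelings with `i`-th entry `x` correspond to the lattice pairs of radius `r / c`, up to
boundary pairs. -/
lemma exists_pairs_of_fiber {c : ℝ} (hc : 0 < c) {U : Euc L ≃ₗᵢ[ℝ] Euc L}
    (hU : ∀ x, x ∈ S.Λs ↔ ∃ y ∈ Λ, x = c • U y) {i j : Fin 3} (hij : i ≠ j) (x : S.Λs) :
    ∃ P : Finset (Euc L × Euc L), openLatticePairs Λ (S.r / c) ⊆ P ∧
      (P : Set (Euc L × Euc L)) ⊆ latticePairs Λ (S.r / c) ∧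
      (S.finite_fiber i x).toFinset.card = P.card ∧
      S.pairSum i j x = c ^ 2 / L * ∑ p ∈ P, ‖p.1‖ ^ 2 := by
  classical
  obtain ⟨k, hik, hjk, hi⟩ : ∃ k : Fin 3, k ≠ i ∧ k ≠ j ∧ ∀ l, l = i ∨ l = j ∨ l = k := by
    revert i j; decide
  have hinj : Set.InjOn (S.labelPair c U i j k) (S.finite_fiber i x).toFinset := by
    rw [Set.Finite.coe_toFinset]
    exact S.labelPair_injOn hc U hi x
  refine ⟨(S.finite_fiber i x).toFinset.image (S.labelPair c U i j k), fun p hp => ?_, ?_, ?_, ?_⟩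
  · obtain ⟨d, hd, hdp⟩ := S.exists_labelPair_eq hc hU hij.symm hik hjk hi x hp
    rw [Finset.mem_coe, Finset.mem_image]
    exact ⟨d, by rwa [Set.Finite.mem_toFinset], hdp⟩
  · rw [Finset.coe_image, Set.image_subset_iff]
    exact fun d _ => S.labelPair_mem hc hU i j k d
  · rw [Finset.card_image_of_injOn hinj]
  · rw [Finset.sum_image hinj, S.pairSum_eq_sum S.finite_fiber, Finset.mul_sum]
    refine Finset.sum_congr rfl fun d _ => ?_
    rw [normSqPerDim_eq, labelPair, norm_inv_smul_symm hc, norm_sub_rev]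
    field_simp

end ThreeChannels

end MDQuantizer

/-! ### The limiting constants -/

/-- The limit of the ratio between pair sums and their sphere-second-moment approximation. -/
def pairRatio (L : ℕ) : ℝ := ((L : ℝ) + 2) / L * (pairMoment L 2 / pairMoment L 0)

/-- The limiting dimensionless expansion factor of three-channel quantizers. -/
def expansionLimit (L : ℕ) : ℝ :=
  (ballVol L ^ 2 / pairMoment L 0) ^ (((2 * L : ℕ) : ℝ)⁻¹)

lemma pairRatio_succ (n : ℕ) : pairRatio (n + 1)
    = ((n : ℝ) + 3) / (n + 1) * (radialMoment n 2 / radialMoment n 0) := by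
  have := ballVol_pos n
  have := ballVol_pos (n + 1)
  have := radialMoment_pos n 0
  rw [pairRatio, pairMoment_eq, pairMoment_eq]
  push_cast
  field_simp
  ring

lemma tendsto_pairRatio : Tendsto pairRatio atTop (𝓝 1) := by
  rw [← tendsto_add_atTop_iff_nat 1]
  simpa only [pairRatio_succ] using tendsto_radialMoment_ratio

lemma pairRatio_odd (m : ℕ) : pairRatio (2 * m + 1)
    = (((2 * m + 1 : ℕ) : ℝ) + 2) / ((2 * m + 1 : ℕ) : ℝ)
      * (beta' (2 * m + 1) / beta (2 * m + 1)) := by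
  have := radialMoment_pos (2 * m) 0
  rw [pairRatio_succ, beta, beta', betaSum_eq, betaSum_eq]
  push_cast
  field_simp
  ring

/-- Here `M₀ = 2 L ω_L ω_{L-1} * radialMoment (L - 1) 0` and `β_L = (L + 1) * radialMoment (L - 1)
0`, whence the factor `(L + 1) / (2 L)`. -/
lemma expansionLimit_odd (m : ℕ) : expansionLimit (2 * m + 1) = psiOdd (2 * m + 1) := by
  have h1 := ballVol_pos (2 * m)
  have h2 := ballVol_pos (2 * m + 1)
  have h3 := radialMoment_pos (2 * m) 0
  have he : (1 : ℝ) / (2 * ((2 * m + 1 : ℕ) : ℝ)) = ((2 * (2 * m + 1) : ℕ) : ℝ)⁻¹ := by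
    push_cast
    rw [one_div]
  rw [psiOdd, he, Nat.add_sub_cancel, beta, betaSum_eq, expansionLimit, pairMoment_eq,
    Real.rpow_neg (by positivity), ← Real.mul_rpow (by positivity) (by positivity),
    ← div_eq_mul_inv, ← Real.div_rpow (by positivity) (by positivity)]
  congr 1
  push_cast
  field_simp
  ring

lemma expansionLimit_pos (n : ℕ) : 0 < expansionLimit (n + 1) := by
  have := ballVol_pos (n + 1)
  have := pairMoment_pos n 0
  unfold expansionLimit
  positivity

lemma abs_average_sub_lt {ι : Type*} {X : Finset ι} (hX : 0 < X.card) {g : ι → ℝ} {a ε : ℝ}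
    (h : ∀ x ∈ X, |g x - a| < ε) : |(∑ x ∈ X, g x) / X.card - a| < ε := by
  have hpos : (0 : ℝ) < X.card := by exact_mod_cast hX
  have e : (∑ x ∈ X, g x) / X.card - a = (∑ x ∈ X, (g x - a)) / X.card := by
    rw [Finset.sum_sub_distrib, Finset.sum_const, nsmul_eq_mul]
    field_simp
  rw [e, abs_div, abs_of_pos hpos, div_lt_iff₀ hpos]
  calc |∑ x ∈ X, (g x - a)| ≤ ∑ x ∈ X, |g x - a| := Finset.abs_sum_le_sum_abs _ _
    _ < ∑ _x ∈ X, ε := Finset.sum_lt_sum_of_nonempty (Finset.card_pos.1 hX) h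
    _ = ε * X.card := by rw [Finset.sum_const, nsmul_eq_mul, mul_comm]

/-! ### Uniform asymptotics in the index -/

namespace MDQuantizer

section Asymptotics

variable {L : ℕ} {Λ : Submodule ℤ (Euc L)} [DiscreteTopology Λ]

/-- The average fiber size `N` cannot exceed the number of available pairs. A bounded radius thus
bounds `N`, so large `N` forces a large radius. -/
lemma index_le_card_latticePairs (S : MDQuantizer 3 L Λ) {c : ℝ} (hc : 0 < c)
    {U : Euc L ≃ₗᵢ[ℝ] Euc L} (hU : ∀ x, x ∈ S.Λs ↔ ∃ y ∈ Λ, x = c • U y) {R : ℝ}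
    (hR : S.r / c ≤ R) : S.N ≤ (finite_latticePairs Λ R).toFinset.card := by
  obtain ⟨X, hX, hsum⟩ := S.exists_sum_cell_eq S.finite_fiber 0
  have h := hsum (fun _ => 1) fun _ _ _ => rfl
  simp only [Finset.sum_const, nsmul_eq_mul, mul_one, S.card_cell] at h
  have hle : ∑ x ∈ X, ((S.finite_fiber 0 x).toFinset.card : ℝ)
      ≤ ∑ _x ∈ X, ((finite_latticePairs Λ R).toFinset.card : ℝ) := by
    refine Finset.sum_le_sum fun x _ => ?_
    obtain ⟨P, -, hP, hcard, -⟩ := S.exists_pairs_of_fiber hc hU (show (0 : Fin 3) ≠ 1 by decide) x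
    rw [hcard]
    exact_mod_cast Finset.card_le_card fun p hp =>
      (finite_latticePairs Λ R).mem_toFinset.2 (latticePairs_mono Λ hR (hP hp))
  rw [← h, Finset.sum_const, hX, nsmul_eq_mul] at hle
  have hN := S.N_pos
  have hle' : S.N ^ 2 ≤ S.N * (finite_latticePairs Λ R).toFinset.card := by exact_mod_cast hle
  rw [sq] at hle'
  exact Nat.le_of_mul_le_mul_left hle' hN

variable [IsZLattice ℝ Λ]

/-- The index, the pair sums and the total pair sums of a three-channel quantizer in terms of the
radius `S.r / c`, uniformly over all quantizers of the same shape. -/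
lemma asymptotics (hL : 0 < L) {ε : ℝ} (hε : 0 < ε) :
    ∃ N₀ : ℕ, ∀ S : MDQuantizer 3 L Λ, N₀ ≤ S.N → ∀ (c : ℝ) (_ : 0 < c) (U : Euc L ≃ₗᵢ[ℝ] Euc L),
      (∀ x, x ∈ S.Λs ↔ ∃ y ∈ Λ, x = c • U y) →
      0 < S.r / c ∧
      |S.N / (S.r / c) ^ (2 * L) - pairMoment L 0 / ZLattice.covolume Λ ^ 2| < ε ∧
      ∀ i j : Fin 3, i ≠ j →
        (∀ x : S.Λs, |S.pairSum i j x / (c ^ 2 / L * (S.r / c) ^ (2 * L + 2))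
          - pairMoment L 2 / ZLattice.covolume Λ ^ 2| < ε) ∧
        |S.totalPairSum i j / (S.N * (c ^ 2 / L * (S.r / c) ^ (2 * L + 2)))
          - pairMoment L 2 / ZLattice.covolume Λ ^ 2| < ε := by
  obtain ⟨R₁, h₁⟩ := sum_latticePairs_asymptotic Λ 0 hε
  obtain ⟨R₂, h₂⟩ := sum_latticePairs_asymptotic Λ 2 hε
  set R₀ := max 1 (max R₁ R₂)
  refine ⟨(finite_latticePairs Λ R₀).toFinset.card + 1, fun S hS c hc U hU => ?_⟩
  have hR : R₀ < S.r / c := by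
    by_contra! hle
    have := S.index_le_card_latticePairs hc hU hle
    omega
  have hR₁ : R₁ ≤ S.r / c := (le_max_left _ _).trans ((le_max_right _ _).trans hR.le)
  have hR₂ : R₂ ≤ S.r / c := (le_max_right _ _).trans ((le_max_right _ _).trans hR.le)
  have hpos : 0 < S.r / c := zero_lt_one.trans_le ((le_max_left _ _).trans hR.le)
  have hN : (0 : ℝ) < S.N := by exact_mod_cast S.N_pos
  refine ⟨hpos, ?_, fun i j hij => ?_⟩
  · obtain ⟨X, hX, hsum⟩ := S.exists_sum_cell_eq S.finite_fiber 0
    have h := hsum (fun _ => 1) fun _ _ _ => rfl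
    simp only [Finset.sum_const, nsmul_eq_mul, mul_one, S.card_cell] at h
    -- The estimate holds for each fiber size with the same error, hence for their average `N`.
    have key := abs_average_sub_lt (X := X) (by rw [hX]; exact S.N_pos)
      (g := fun x => ((S.finite_fiber 0 x).toFinset.card : ℝ) / (S.r / c) ^ (2 * L))
      (a := pairMoment L 0 / ZLattice.covolume Λ ^ 2) (ε := ε) fun x _ => by
        obtain ⟨P, hP1, hP2, hcard, -⟩ :=
          S.exists_pairs_of_fiber hc hU (show (0 : Fin 3) ≠ 1 by decide) x
        have := h₁ _ hR₁ P hP1 hP2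
        simpa [hcard] using this
    rw [← Finset.sum_div, ← h, hX] at key
    convert key using 3
    push_cast
    field_simp
  · have hL' : 0 < (L : ℝ) := by exact_mod_cast hL
    have hpair : ∀ x : S.Λs, |S.pairSum i j x / (c ^ 2 / L * (S.r / c) ^ (2 * L + 2))
        - pairMoment L 2 / ZLattice.covolume Λ ^ 2| < ε := fun x => by
      obtain ⟨P, hP1, hP2, -, hsum⟩ := S.exists_pairs_of_fiber hc hU hij x
      have := h₂ _ hR₂ P hP1 hP2
      rw [hsum, mul_div_mul_left _ _ (by positivity)]
      exact this
    refine ⟨hpair, ?_⟩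
    obtain ⟨X, hX, hsum⟩ := S.exists_sum_cell_eq S.finite_fiber i
    have h := hsum _ (S.normSqPerDim_sub_eq_of_mem i j)
    simp only [← S.pairSum_eq_sum S.finite_fiber] at h
    have key := abs_average_sub_lt (X := X) (by rw [hX]; exact S.N_pos) fun x _ => hpair x
    rw [← Finset.sum_div, ← h, hX, div_div, mul_comm _ (S.N : ℝ)] at key
    exact key

end Asymptotics

/-! ### Normalizing by `rBar` and `sphereG` -/

section Normalization

variable {n : ℕ} {Λ : Submodule ℤ (Euc (n + 1))} (S : MDQuantizer 3 (n + 1) Λ)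

lemma r_nonneg : 0 ≤ S.r := by
  simpa using S.tuples_le 0 0 0

lemma rBar_eq : S.rBar
    = (S.nuS * (S.N : ℝ) ^ (1 / 2 : ℝ) / ballVol (n + 1)) ^ (((n + 1 : ℕ) : ℝ)⁻¹) := by
  rw [rBar, one_div ((n + 1 : ℕ) : ℝ)]
  norm_num

lemma nuTilde_rpow_mul_sphereG :
    S.nuTilde ^ (2 / ((n + 1 : ℕ) : ℝ)) * sphereG (n + 1) = S.r ^ 2 / (((n + 1 : ℕ) : ℝ) + 2) := by
  have hω := ballVol_pos (n + 1)
  have hr := S.r_nonneg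
  have hL : ((n + 1 : ℕ) : ℝ) ≠ 0 := by positivity
  have h : S.nuTilde = S.r ^ (n + 1) * ballVol (n + 1) := volume_real_closedBall 0 hr
  rw [h, sphereG_eq, Real.mul_rpow (by positivity) hω.le, ← Real.rpow_natCast S.r,
    ← Real.rpow_mul hr, mul_div_cancel₀ _ hL, Real.rpow_two, mul_div_assoc', mul_assoc,
    ← Real.rpow_add hω, add_neg_cancel, Real.rpow_zero, mul_one]

variable [DiscreteTopology Λ] [IsZLattice ℝ Λ]

lemma nuS_eq : S.nuS = S.N * S.nu := by
  obtain ⟨_, _⟩ := S.similar_c.isZLattice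
  obtain ⟨_, _⟩ := (S.similar_c.trans S.similar_s).isZLattice
  have h := ZLattice.covolume_div_covolume_eq_relIndex' S.Λs S.Λc S.s_le_c
  have hne : ZLattice.covolume S.Λc volume ≠ 0 := ZLattice.covolume_ne_zero S.Λc volume
  rw [S.index_s, div_eq_iff hne] at h
  exact h

lemma nu_pos : 0 < S.nu := by
  obtain ⟨_, _⟩ := S.similar_c.isZLattice
  exact ZLattice.covolume_pos S.Λc

lemma rBar_pos : 0 < S.rBar := by
  have h1 := S.nu_pos
  have h2 := ballVol_pos (n + 1)
  have h3 : (0 : ℝ) < S.N := by exact_mod_cast S.N_pos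
  rw [rBar_eq, nuS_eq]
  positivity

/-- The exponent `3 / L` arises from `ν_s √N = ν N ^ (3 / 2)`, raised to the power `2 / L`. -/
lemma rBar_sq : S.rBar ^ 2 = S.nu ^ (2 / ((n + 1 : ℕ) : ℝ)) *
    (S.N : ℝ) ^ (3 / ((n + 1 : ℕ) : ℝ)) * ballVol (n + 1) ^ (-(2 / ((n + 1 : ℕ) : ℝ))) := by
  have h1 := S.nu_pos
  have h2 := ballVol_pos (n + 1)
  have h3 : (0 : ℝ) < S.N := by exact_mod_cast S.N_pos
  rw [rBar_eq, nuS_eq, ← Real.rpow_natCast, ← Real.rpow_mul (by positivity), div_eq_mul_inv,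
    ← Real.rpow_neg_one (ballVol (n + 1)),
    show (S.N : ℝ) * S.nu * (S.N : ℝ) ^ (1 / 2 : ℝ) = S.nu * (S.N : ℝ) ^ (3 / 2 : ℝ) by
      rw [show (3 / 2 : ℝ) = 1 + 1 / 2 by norm_num, Real.rpow_add h3, Real.rpow_one]; ring,
    Real.mul_rpow (by positivity) (by positivity), Real.mul_rpow (by positivity) (by positivity),
    ← Real.rpow_mul h3.le, ← Real.rpow_mul h2.le]
  congr 3 <;> push_cast <;> ring

lemma sphereG_mul_rpow : sphereG (n + 1) * (S.N : ℝ) ^ ((2 * 3 : ℝ) / (((n + 1 : ℕ) : ℝ) * (3 - 1)))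
      * S.nu ^ (2 / ((n + 1 : ℕ) : ℝ)) = S.rBar ^ 2 / (((n + 1 : ℕ) : ℝ) + 2) := by
  rw [rBar_sq, sphereG_eq, show (2 * 3 : ℝ) / (((n + 1 : ℕ) : ℝ) * (3 - 1)) =
    3 / ((n + 1 : ℕ) : ℝ) by field_simp; norm_num]
  ring

/-- The scale `c` cancels in the `2L`-th power, leaving `N / (r / c) ^ (2L)`, whose limit is known,
as the only quantity depending on the quantizer. -/
lemma expansion_eq {c : ℝ} (hc : 0 < c) {U : Euc (n + 1) ≃ₗᵢ[ℝ] Euc (n + 1)}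
    (hU : ∀ x, x ∈ S.Λs ↔ ∃ y ∈ Λ, x = c • U y) (hr : 0 < S.r / c) :
    S.expansion = (ballVol (n + 1) ^ 2 / (S.N / (S.r / c) ^ (2 * (n + 1)) *
      ZLattice.covolume Λ ^ 2)) ^ (((2 * (n + 1) : ℕ) : ℝ)⁻¹) := by
  have h1 := S.rBar_pos
  have h2 := ballVol_pos (n + 1)
  have h3 : (0 : ℝ) < S.N := by exact_mod_cast S.N_pos
  have h4 := ZLattice.covolume_pos Λ
  have h5 : 0 < S.r := (div_pos_iff_of_pos_right hc).1 hr
  have h6 : S.nuS = c ^ (n + 1) * ZLattice.covolume Λ := covolume_similar hc hU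
  have hpow : S.rBar ^ (2 * (n + 1))
      = (c ^ (n + 1) * ZLattice.covolume Λ) ^ 2 * S.N / ballVol (n + 1) ^ 2 := by
    rw [rBar_eq, mul_comm 2, pow_mul, Real.rpow_inv_natCast_pow (by rw [h6]; positivity)
      (by omega), h6, div_pow, mul_pow, ← Real.rpow_natCast ((S.N : ℝ) ^ (1 / 2 : ℝ)),
      ← Real.rpow_mul h3.le]
    norm_num
  have e : S.expansion ^ (2 * (n + 1)) = ballVol (n + 1) ^ 2 /
      (S.N / (S.r / c) ^ (2 * (n + 1)) * ZLattice.covolume Λ ^ 2) := by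
    rw [expansion, div_pow, hpow, div_pow, mul_pow, ← pow_mul, mul_comm (n + 1) 2]
    field_simp
  have hnn : 0 ≤ S.expansion := div_nonneg h5.le h1.le
  rw [← e, Real.pow_rpow_inv_natCast hnn (by omega)]

end Normalization

end MDQuantizer

end

theorem mainTheorem4 :
    ∃ ρ ψ : ℕ → ℝ,
      -- for each dimension `L`: the limits as `N → ∞`, uniformly in the scale of the lattices
      (∀ L : ℕ, 0 < L → ∀ (Λ : Submodule ℤ (Euc L)) [DiscreteTopology Λ] [IsZLattice ℝ Λ],
        ∀ ε : ℝ, 0 < ε → ∃ N₀ : ℕ, ∀ S : MDQuantizer 3 L Λ, N₀ ≤ S.N →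
          |S.expansion - ψ L| < ε ∧
          ∀ i j : Fin 3, i ≠ j →
            (∀ x : S.Λs,
              |S.pairSum i j x / ((S.N : ℝ) * S.nuTilde ^ (2 / (L : ℝ)) * sphereG L) - ρ L| < ε) ∧
            |S.totalPairSum i j /
                (sphereG L * ψ L ^ 2 * (S.N : ℝ) ^ 2 *
                  (S.N : ℝ) ^ ((2 * 3 : ℝ) / ((L : ℝ) * (3 - 1))) * S.nu ^ (2 / (L : ℝ)))
              - ρ L| < ε) ∧
      -- the limiting ratios tend to one as `L → ∞`
      Tendsto ρ atTop (𝓝 1) ∧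
      -- the closed forms in odd dimensions
      (∀ L : ℕ, Odd L → ψ L = psiOdd L ∧
        ρ L = ((L : ℝ) + 2) / L * (beta' L / beta L)) ∧
      Tendsto (fun m : ℕ => (((2 * m + 1 : ℕ) : ℝ) + 2) / ((2 * m + 1 : ℕ) : ℝ) *
        (beta' (2 * m + 1) / beta (2 * m + 1))) atTop (𝓝 1) := by
  refine ⟨pairRatio, expansionLimit, ?_, tendsto_pairRatio, ?_, ?_⟩
  · intro L hL Λ _ _ ε hε
    obtain ⟨n, rfl⟩ : ∃ n, L = n + 1 := ⟨L - 1, by omega⟩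
    set κ := ZLattice.covolume Λ
    have hκ : 0 < κ := ZLattice.covolume_pos Λ
    have hω := ballVol_pos (n + 1)
    have hI0 := pairMoment_pos n 0
    have hψ := expansionLimit_pos n
    set a := pairMoment (n + 1) 0 / κ ^ 2 with ha
    set b := pairMoment (n + 1) 2 / κ ^ 2 with hb
    have ha0 : 0 < a := by positivity
    let F : ℝ → ℝ := fun y =>
      (ballVol (n + 1) ^ 2 / (y * κ ^ 2)) ^ (((2 * (n + 1) : ℕ) : ℝ)⁻¹)
    let G : ℝ × ℝ → ℝ := fun y => (((n + 1 : ℕ) : ℝ) + 2) / ((n + 1 : ℕ) : ℝ) * (y.2 / y.1)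
    -- The total pair sum is normalized with the limit `ψ_L` instead of the actual expansion, hence
    -- the correction factor, which tends to `1`.
    let H : ℝ × ℝ → ℝ := fun y => G y * (F y.1 / expansionLimit (n + 1)) ^ 2
    have hF : ContinuousAt F a := by
      refine ContinuousAt.rpow_const ?_ (Or.inl (by positivity))
      exact ContinuousAt.div₀ continuousAt_const (by fun_prop) (by positivity)
    have hG : ContinuousAt G (a, b) :=
      continuousAt_const.mul (continuousAt_snd.div₀ continuousAt_fst ha0.ne')
    have hF1 : ContinuousAt (fun y : ℝ × ℝ => F y.1) (a, b) :=
      ContinuousAt.comp (f := Prod.fst) (x := (a, b)) hF continuousAt_fst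
    have hH : ContinuousAt H (a, b) := hG.mul ((hF1.div_const _).pow 2)
    have hFa : F a = expansionLimit (n + 1) := by
      simp only [F, expansionLimit, ha]
      congr 2
      field_simp
    have hGa : G (a, b) = pairRatio (n + 1) := by
      simp only [G, pairRatio, ha, hb]
      field_simp
    have hHa : H (a, b) = pairRatio (n + 1) := by
      simp only [H]
      rw [hGa, hFa, div_self hψ.ne', one_pow, mul_one]
    obtain ⟨δ₁, hδ₁, h₁⟩ := Metric.continuousAt_iff.1 hF1 ε hε
    obtain ⟨δ₂, hδ₂, h₂⟩ := Metric.continuousAt_iff.1 hG ε hε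
    obtain ⟨δ₃, hδ₃, h₃⟩ := Metric.continuousAt_iff.1 hH ε hε
    rw [hFa] at h₁
    rw [hGa] at h₂
    rw [hHa] at h₃
    obtain ⟨N₀, hN₀⟩ := MDQuantizer.asymptotics (Λ := Λ) hL (lt_min hδ₁ (lt_min hδ₂ hδ₃))
    refine ⟨N₀, fun S hS => ?_⟩
    obtain ⟨c, U, hc, hU⟩ := S.similar_c.trans S.similar_s
    obtain ⟨hr, hA, hB⟩ := hN₀ S hS c hc U hU
    have hr' : 0 < S.r := (div_pos_iff_of_pos_right hc).1 hr
    have hN : (0 : ℝ) < S.N := by exact_mod_cast S.N_pos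
    have hrB := S.rBar_pos
    have hexp : S.expansion = F (S.N / (S.r / c) ^ (2 * (n + 1))) := S.expansion_eq hc hU hr
    have hpow : (S.r / c) ^ (2 * (n + 1) + 2) = (S.r / c) ^ (2 * (n + 1)) * (S.r ^ 2 / c ^ 2) := by
      rw [pow_add, div_pow S.r c 2]
    have hpos : 0 < (S.r / c) ^ (2 * (n + 1)) := by positivity
    have hdist : ∀ {x y : ℝ}, |x - a| < min δ₁ (min δ₂ δ₃) → |y - b| < min δ₁ (min δ₂ δ₃) →
        dist (x, y) (a, b) < min δ₁ (min δ₂ δ₃) := fun hx hy => by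
      rw [Prod.dist_eq]
      exact max_lt hx hy
    refine ⟨?_, fun i j hij => ⟨fun x => ?_, ?_⟩⟩
    -- The channels `0` and `1` are arbitrary: the second coordinate only serves to be near `b`.
    · have := h₁ ((hdist hA ((hB 0 1 (by decide)).2)).trans_le (min_le_left _ _))
      rw [hexp]
      exact this
    · have := h₂ ((hdist hA ((hB i j hij).1 x)).trans_le
        ((min_le_right _ _).trans (min_le_left _ _)))
      rw [Real.dist_eq] at this
      convert this using 3
      rw [mul_assoc, S.nuTilde_rpow_mul_sphereG]
      simp only [G, hpow]
      field_simp
    · have := h₃ ((hdist hA (hB i j hij).2).trans_le ((min_le_right _ _).trans (min_le_right _ _)))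
      rw [Real.dist_eq] at this
      convert this using 3
      simp only [H]
      rw [← hexp, show ∀ g p N M v : ℝ, g * p ^ 2 * N ^ 2 * M * v = (g * M * v) * p ^ 2 * N ^ 2 by
        intros; ring, S.sphereG_mul_rpow, MDQuantizer.expansion]
      simp only [G, hpow]
      field_simp
  · rintro L ⟨m, rfl⟩
    exact ⟨expansionLimit_odd m, pairRatio_odd m⟩
  · simp only [← pairRatio_odd]
    refine tendsto_pairRatio.comp (tendsto_atTop_mono (fun m => ?_) tendsto_id)
    simp only [id]
    omega
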